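/- **Setting.** Let $F$ be a non-archimedean local field of residual characteristic $\neq 2$ with ring of integers $\mathcal O_F$, maximal ideal $\mathfrak p_F$ and uniformiser $\varpi$. Let $E=F[\sqrt\epsilon]$, with $\epsilon\in\mathcal O_F^\times$ a non-square, be its unramified quadratic extension, with ring of integers $\mathcal O_E$, maximal ideal $\mathfrak p_E=\varpi\mathcal O_E$ and nontrivial $F$-automorphism $x\mapsto\overline x$. Fix an additive character $\psi'$ of $F$ that is trivial on $\mathfrak p_F$ and nontrivial on $\mathcal O_F$, and put $\psi(x)=\psi'\big(\tfrac{x+\overline x}{2}\big)$ for $x\in E$. Let $G=\{g\in \mathrm{GL}_2(E)\mid \overline g^{\top}\mathrm w g=\mathrm w\}$ with $\mathrm w=\begin{pmatrix}0&1\\1&0\end{pmatrix}$, let $\mathcal K=G\cap \mathrm{GL}_2(\mathcal O_E)$, let $Z$ be the center of $G$ (the scalar matrices in $G$), let $T=\{t(a)=\mathrm{diag}(a,\overline a^{-1})\mid a\in E^\times\}$ and let $S=\{\mathrm{diag}(b,b^{-1})\mid b\in F^\times\}\subset T$. For $n\ge 1$ let $T_n=\{t(a)\mid a\in 1+\mathfrak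 p_E^n\}$ and let $S_n=\{\mathrm{diag}(b,b^{-1})\mid b\in1+\mathfrak p_F^n\}$. A character $\chi:T\to\mathbb C^\times$ has minimal depth $r\in\mathbb Z_{>0}$ if $\chi$ is trivial on $T_{r+1}$ and nontrivial on $T_r$, and the same holds for its restriction to $S$ with $S_{r+1}$, $S_r$. Its central character $\theta=\chi|_Z$ has depth zero if it is trivial on the scalars in $Z$ that lie in $1+\mathfrak p_E$. **The representations $\mathcal S_d(X,\zeta)$.** For $d\ge1$ let $\mathcal J_d$ be the subgroup of all $k=(k_{ij})\in\mathcal K$ with $k_{11}-1,\,k_{12},\,k_{22}-1\in\mathfrak p_E^{\lceil d/2\rceil}$ and $k_{21}\in\mathfrak p_E^{\lceil (d+1)/2\rceil}$. For $X\in M_2(E)$ let $T(X)$ be the centralizer of $X$ in $\mathcal K$, and let $\zeta$ be a character of $T(X)$. We say that $\mathcal S_d(X,\zeta)$ is well defined if there is a (necessarily unique) character $\Psi_{X,\zeta}$ of the group $T(X)\mathcal J_d$ generated by $T(X)$ and $\mathcal J_d$ that extends $\zeta$ and equals $\psi(\mathrm{Tr}(X(k-I)))$ at each $k\in\mathcal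 J_d$. In that case $\mathcal S_d(X,\zeta)=\mathrm{Ind}_{T(X)\mathcal J_d}^{\mathcal K}\Psi_{X,\zeta}$ (smooth induction). *Nilpotent elements.* Let $X_{\varpi^{-d}}=\begin{pmatrix}0&\varpi^{-d}\sqrt\epsilon\\0&0\end{pmatrix}$. Then $T(X_{\varpi^{-d}})=Z\,\mathcal U$, where $\mathcal U$ is the group of upper triangular unipotent matrices in $\mathcal K$. For a character $\theta$ of $Z$ we write $\mathcal S_d(X_{\varpi^{-d}},\theta)$ for $\mathcal S_d(X_{\varpi^{-d}},\zeta)$, where $\zeta$ is the character of $Z\,\mathcal U$ that extends $\theta$ and is trivial on $\mathcal U$. *The elements $Y_\chi$.* Let $\chi$ have minimal depth $r>0$. A matrix $\Gamma=\mathrm{diag}(x,-\overline x)$ with $x\in\mathfrak p_E^{-r}$ is said to realize $\chi$ if $\chi(t)=\psi(\mathrm{Tr}(\Gamma(t-I)))$ for all $t\in T_{\lfloor r/2\rfloor+1}$. Then $x+\overline x\ne0$, and for $d\geq 1$ we put $$\gamma=\tfrac12(x+\overline x)\varpi^d\sqrt\epsilon,\qquad g_d=\begin{pmatrix}1&-\frac12\gamma^{-1}\\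 \gamma&\frac12\end{pmatrix}\in G,\qquad Y_\chi=g_d\Gamma g_d^{-1},$$ and $\zeta_\chi(k)=\chi(g_d^{-1}kg_d)$ for $k\in T(Y_\chi)$ (one has $g_d^{-1}T(Y_\chi)g_d\subset T$). **Theorem.** Let $\chi$ be a character of $T$ of minimal depth $r>0$ whose central character $\theta=\chi|_Z$ has depth zero. 1. There is a matrix $\Gamma$ that realizes $\chi$. 2. For every $\Gamma$ that realizes $\chi$ and every integer $d>2r$, the representations $\mathcal S_d(Y_\chi,\zeta_\chi)$ and $\mathcal S_d(X_{\varpi^{-d}},\theta)$ are well defined, and there is an isomorphism of representations of $\mathcal K$ $$\mathcal S_d(Y_\chi,\zeta_\chi)\;\cong\;\mathcal S_d(X_{\varpi^{-d}},\theta).$$ 3. Consequently these components depend only on the central character: if $\chi'$ is another character of $T$, of minimal depth $r'>0$, with $\chi'|_Z=\chi|_Z$, then for all $d>2\max(r,r')$ and all choices of matrices realizing $\chi$ and $\chi'$, the representations $\mathcal S_d(Y_\chi,\zeta_\chi)$ and $\mathcal S_d(Y_{\chi'},\zeta_{\chi'})$ are well defined and isomorphic. -/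

import Mathlib

open ValuativeRel Matrix

noncomputable section

/-! ### Smooth induction of a character of a subgroup -/

section Induction

variable {K : Type*} [Group K] [TopologicalSpace K] [ContinuousMul K]

/-- The space of `Ind_H^K Ψ`, for a character `Ψ` of a subgroup `H` of `K`: the locally constant
functions `f : K → ℂ` with `f (h g) = Ψ h * f g` for all `h ∈ H` and `g ∈ K`. -/
def indSpace (H : Subgroup K) (Ψ : H →* ℂˣ) : Submodule ℂ (K → ℂ) where
  carrier := {f | IsLocallyConstant f ∧ ∀ (h : H) (g : K), f ((h : K) * g) = (Ψ h : ℂ) * f g}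
  add_mem' := by
    rintro f f' ⟨hf, hf'⟩ ⟨h1, h2⟩
    refine ⟨hf.add h1, fun h g => ?_⟩
    simp only [Pi.add_apply, hf', h2, mul_add]
  zero_mem' := ⟨IsLocallyConstant.const 0, fun h g => by simp⟩
  smul_mem' := by
    rintro c f ⟨hf, hf'⟩
    refine ⟨hf.comp (fun z => c • z), fun h g => ?_⟩
    simp only [Pi.smul_apply, hf', smul_eq_mul]
    ring

/-- The induced representation `Ind_H^K Ψ`: `K` acts on `indSpace H Ψ` by right translation,
`(g • f) x = f (x g)`. -/
def indRep (H : Subgroup K) (Ψ : H →* ℂˣ) : Representation ℂ K (indSpace H Ψ) where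
  toFun g := (LinearMap.funLeft ℂ ℂ (fun x : K => x * g)).restrict (by
    rintro f ⟨hf, hf'⟩
    refine ⟨hf.comp_continuous (continuous_mul_const g), fun h x => ?_⟩
    simp only [LinearMap.funLeft_apply, mul_assoc, hf'])
  map_one' := by
    ext f x
    simp [LinearMap.funLeft_apply]
  map_mul' g g' := by
    ext f x
    simp [LinearMap.funLeft_apply, mul_assoc]

end Induction

/-! ### Depth -/

/-- Let `fil` be the filtration of a group `M` by `M_0, M_1, M_2, …`.  The character `χ` has
depth `r` if it is trivial on `M_{r+1}` and, when `r > 0`, nontrivial on `M_r`.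
(A character that is trivial on `M_0` has depth zero, too.) -/
def HasDepth {M : Type*} [Group M] (fil : ℕ → Set M) (χ : M →* ℂˣ) (r : ℕ) : Prop :=
  (r = 0 ∨ ∃ t ∈ fil r, χ t ≠ 1) ∧ ∀ t ∈ fil (r + 1), χ t = 1

/-- For a field `L` with a valuation and an element `π`, the set of `x` with `|x| ≤ |π| ^ n`.
It is the fractional ideal `𝔭_L ^ n` when `π` is a uniformiser of `L`. -/
def idealPow {L : Type*} [Field L] [ValuativeRel L] (π : L) (n : ℤ) : Set L :=
  {x | valuation L x ≤ valuation L π ^ n}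

theorem idealPow_add {L : Type*} [Field L] [ValuativeRel L] {π : L} {n : ℤ} {x y : L}
    (hx : x ∈ idealPow π n) (hy : y ∈ idealPow π n) : x + y ∈ idealPow π n :=
  show valuation L (x + y) ≤ _ from (valuation L).map_add_le
    (show valuation L x ≤ valuation L π ^ n from hx) hy

theorem idealPow_mul {L : Type*} [Field L] [ValuativeRel L] {π : L} {n : ℤ} {x y : L}
    (hx : x ∈ idealPow π n) (hy : valuation L y ≤ 1) : x * y ∈ idealPow π n := by
  change valuation L (x * y) ≤ _
  rw [map_mul]
  exact (mul_le_mul' hx hy).trans (mul_one _).le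

/-- The filtration of `Lˣ`: the units `𝒪_L ˣ` of the ring of integers for `n = 0`, and
`1 + 𝔭_L ^ n` for `n ≥ 1` (where `π` is a uniformiser). -/
def unitFil {L : Type*} [Field L] [ValuativeRel L] (π : L) (n : ℕ) : Set Lˣ :=
  {a | valuation L (a : L) = 1 ∧ (a : L) - 1 ∈ idealPow π n}

/-! ### The field extension, the groups and the representations -/

/-- The fixed data: for a non-archimedean local field `F` of residual characteristic not two,
the quadratic unramified extension `E = F[√ε]`, where `ε` is a nonsquare unit of `𝒪_F`,
its nontrivial automorphism `σ` over `F`, a uniformiser `ϖ` of `F`, and an additive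
character `ψ'` of `F` that is trivial on `𝔭_F` and nontrivial on `𝒪_F`. -/
structure UnramifiedData (F E : Type*)
    [Field F] [ValuativeRel F] [TopologicalSpace F] [IsNonarchimedeanLocalField F]
    [Field E] [Algebra F E] where
  residueChar_ne_two : ringChar 𝓀[F] ≠ 2
  ε : F
  ε_unit : valuation F ε = 1
  ε_nonsquare : ¬ IsSquare ε
  sqrtε : E
  sqrtε_sq : sqrtε ^ 2 = algebraMap F E ε
  adjoin_sqrtε : Algebra.adjoin F {sqrtε} = ⊤
  σ : E ≃ₐ[F] E
  σ_ne_one : σ ≠ 1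
  ϖ : 𝒪[F]
  ϖ_uniformiser : Irreducible ϖ
  ψ' : AddChar F ℂ
  ψ'_trivial : ∀ y : 𝒪[F], y ∈ 𝓂[F] → ψ' y = 1
  ψ'_nontrivial : ∃ y : 𝒪[F], ψ' y ≠ 1

set_option linter.unusedSectionVars false

namespace UnramifiedData

variable {F E : Type*}
  [Field F] [ValuativeRel F] [TopologicalSpace F] [IsNonarchimedeanLocalField F]
  [Field E] [ValuativeRel E] [TopologicalSpace E] [IsNonarchimedeanLocalField E]
  [Algebra F E] [ValuativeExtension F E]


/-- The fractional ideal `𝔭_E ^ n = {x ∈ E | ν x ≥ n}`, where `ν` is the valuation of `E` that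
extends the one of `F` with `ν ϖ = 1`. -/
def pE (D : UnramifiedData F E) (n : ℤ) : Set E := idealPow (algebraMap F E D.ϖ) n

theorem pE_anti (D : UnramifiedData F E) {m n : ℕ} (h : m ≤ n) {x : E} (hx : x ∈ D.pE n) :
    x ∈ D.pE m := by
  have h1 : valuation F (D.ϖ : F) ≤ valuation F 1 := by
    rw [map_one]
    exact D.ϖ.2
  rw [← (valuation F).vle_iff_le, ← ValuativeExtension.vle_iff_vle (B := E),
    (valuation E).vle_iff_le, map_one, map_one] at h1
  simp only [pE, idealPow, Set.mem_ofPred_eq, zpow_natCast] at hx ⊢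
  exact hx.trans (pow_le_pow_right_of_le_one' h1 h)

/-- The additive character `ψ x = ψ' ((x + σ x) / 2)` of `E`. -/
def ψ (D : UnramifiedData F E) (x : E) : ℂ := D.ψ' (Algebra.trace F E x / 2)

/-- The matrix `w` of the hermitian form. -/
def w : Matrix (Fin 2) (Fin 2) E := !![0, 1; 1, 0]

/-- The unitary group `G = U(1,1)(F)` of all `g` with `(σ g)ᵀ w g = w`. -/
def G (D : UnramifiedData F E) : Subgroup (GL (Fin 2) E) where
  carrier := {g | ((g : Matrix (Fin 2) (Fin 2) E).map D.σ)ᵀ * w * (g : Matrix (Fin 2) (Fin 2) E) = w}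
  one_mem' := by
    simp only [Set.mem_ofPred_eq, Units.val_one]
    rw [Matrix.map_one _ (map_zero _) (map_one _)]
    simp
  mul_mem' := by
    intro a b ha hb
    simp only [Set.mem_ofPred_eq, Units.val_mul] at *
    rw [Matrix.map_mul, Matrix.transpose_mul]
    calc _ = ((b : Matrix (Fin 2) (Fin 2) E).map D.σ)ᵀ *
          (((a : Matrix (Fin 2) (Fin 2) E).map D.σ)ᵀ * w * (a : Matrix (Fin 2) (Fin 2) E)) *
          (b : Matrix (Fin 2) (Fin 2) E) := by simp only [Matrix.mul_assoc]
      _ = _ := by rw [ha, hb]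
  inv_mem' := by
    intro a ha
    simp only [Set.mem_ofPred_eq] at *
    have h1 : (a : Matrix (Fin 2) (Fin 2) E) * ((a⁻¹ : GL (Fin 2) E) : Matrix (Fin 2) (Fin 2) E)
        = 1 := by rw [← Units.val_mul, mul_inv_cancel, Units.val_one]
    have h2 : (((a⁻¹ : GL (Fin 2) E) : Matrix (Fin 2) (Fin 2) E).map D.σ)ᵀ *
        ((a : Matrix (Fin 2) (Fin 2) E).map D.σ)ᵀ = 1 := by
      rw [← Matrix.transpose_mul, ← Matrix.map_mul, h1,
        Matrix.map_one _ (map_zero _) (map_one _), Matrix.transpose_one]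
    conv_lhs => rw [← ha]
    calc _ = ((((a⁻¹ : GL (Fin 2) E) : Matrix (Fin 2) (Fin 2) E).map D.σ)ᵀ *
        ((a : Matrix (Fin 2) (Fin 2) E).map D.σ)ᵀ) * w * ((a : Matrix (Fin 2) (Fin 2) E) *
        ((a⁻¹ : GL (Fin 2) E) : Matrix (Fin 2) (Fin 2) E)) := by simp only [Matrix.mul_assoc]
      _ = _ := by rw [h1, h2]; simp

/-- The maximal compact subgroup `𝒦 = G ∩ GL₂(𝒪_E)`. -/
def K (D : UnramifiedData F E) : Subgroup (GL (Fin 2) E) :=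
  D.G ⊓ (GeneralLinearGroup.map (n := Fin 2) (𝒪[E]).subtype).range

/-- The element `t(a) = diag(a, (σ a)⁻¹)`, for `a ∈ Eˣ`. -/
def tor (D : UnramifiedData F E) : Eˣ →* GL (Fin 2) E where
  toFun a := GeneralLinearGroup.mkOfDetNeZero !![(a : E), 0; 0, (D.σ a)⁻¹] (by
    simp [Matrix.det_fin_two])
  map_one' := by
    ext i j
    fin_cases i <;> fin_cases j <;> simp [GeneralLinearGroup.mkOfDetNeZero]
  map_mul' a b := by
    ext i j
    fin_cases i <;> fin_cases j <;>
      simp [GeneralLinearGroup.mkOfDetNeZero, Matrix.mul_apply, mul_comm]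

theorem tor_val (D : UnramifiedData F E) (a : Eˣ) :
    (D.tor a : Matrix (Fin 2) (Fin 2) E) = !![(a : E), 0; 0, (D.σ a)⁻¹] := rfl

/-- The diagonal torus `T` of `G`. -/
def T (D : UnramifiedData F E) : Subgroup (GL (Fin 2) E) := D.tor.range

/-- The isomorphism `a ↦ t(a)` from `Eˣ` to `T`. -/
def t (D : UnramifiedData F E) : Eˣ →* D.T := D.tor.rangeRestrict

/-- The filtration of `T`: `T_n = {t(a) | a ∈ 1 + 𝔭_E ^ n}` (and `a ∈ 𝒪_E ˣ` for `n = 0`). -/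
def Tfil (D : UnramifiedData F E) (n : ℕ) : Set D.T :=
  D.t '' unitFil (algebraMap F E D.ϖ) n

/-- The filtration of the maximal split subtorus `S = {diag(b, b⁻¹) | b ∈ Fˣ}` of `T`:
`S_n = {diag(b, b⁻¹) | b ∈ 1 + 𝔭_F ^ n}` (and `b ∈ 𝒪_F ˣ` for `n = 0`). -/
def Sfil (D : UnramifiedData F E) (n : ℕ) : Set D.T :=
  (fun b : Fˣ => D.t (Units.map (algebraMap F E : F →* E) b)) '' unitFil (D.ϖ : F) n

/-- The character `χ` of `T` has minimal depth `r` if its depth and its true depth (the depth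
of its restriction to `S`) are both equal to `r`. -/
def HasMinimalDepth (D : UnramifiedData F E) (χ : D.T →* ℂˣ) (r : ℕ) : Prop :=
  HasDepth D.Tfil χ r ∧ HasDepth D.Sfil χ r

/-- The center `Z` of `G`, the group of scalar matrices in `G`. -/
def Z (D : UnramifiedData F E) : Subgroup (GL (Fin 2) E) :=
  D.G ⊓ (GeneralLinearGroup.scalar (R := E) (Fin 2)).range

/-- The filtration of `Z`: scalars in `1 + 𝔭_E ^ n` (and `Z_0 = Z`). -/
def Zfil (D : UnramifiedData F E) (n : ℕ) : Set D.Z :=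
  {z | ∃ a ∈ unitFil (algebraMap F E D.ϖ) n,
    (z : GL (Fin 2) E) = GeneralLinearGroup.scalar (Fin 2) a}

theorem scalar_mem_G_iff (D : UnramifiedData F E) (a : Eˣ) :
    GeneralLinearGroup.scalar (Fin 2) a ∈ D.G ↔ D.σ (a : E) * a = 1 := by
  change (((GeneralLinearGroup.scalar (Fin 2) a : GL (Fin 2) E) :
    Matrix (Fin 2) (Fin 2) E).map D.σ)ᵀ * w * _ = w ↔ _
  rw [← Matrix.ext_iff]
  simp [w, Matrix.mul_apply, Fin.forall_fin_two, GeneralLinearGroup.scalar, Matrix.scalar]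

theorem Z_le_T (D : UnramifiedData F E) : D.Z ≤ D.T := by
  rintro g ⟨hg, a, rfl⟩
  have h := (D.scalar_mem_G_iff a).1 hg
  refine ⟨a, ?_⟩
  have h2 : (D.σ (a : E))⁻¹ = a := inv_eq_of_mul_eq_one_right h
  ext i j
  fin_cases i <;> fin_cases j <;>
    simp [tor, GeneralLinearGroup.mkOfDetNeZero, GeneralLinearGroup.scalar, h2]

/-- The restriction of `χ` to the center `Z` of `G`.  It is the central character of the
principal series representation `Ind_B^G χ`. -/
def centralChar (D : UnramifiedData F E) (χ : D.T →* ℂˣ) : D.Z →* ℂˣ :=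
  χ.comp (Subgroup.inclusion D.Z_le_T)

/-- The centralizer `T(X)` of the matrix `X` in `𝒦`. -/
def cent (D : UnramifiedData F E) (X : Matrix (Fin 2) (Fin 2) E) : Subgroup D.K where
  carrier := {k | ((k : GL (Fin 2) E) : Matrix (Fin 2) (Fin 2) E) * X =
    X * ((k : GL (Fin 2) E) : Matrix (Fin 2) (Fin 2) E)}
  one_mem' := by simp
  mul_mem' := by
    intro a b ha hb
    simp only [Set.mem_ofPred_eq, Subgroup.coe_mul, Units.val_mul] at *
    rw [Matrix.mul_assoc, hb, ← Matrix.mul_assoc, ha, Matrix.mul_assoc]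
  inv_mem' := by
    intro a ha
    have h : Commute ((a : GL (Fin 2) E) : Matrix (Fin 2) (Fin 2) E) X := ha
    exact h.units_inv_left

theorem entry_mem (D : UnramifiedData F E) (k : D.K) (i j : Fin 2) :
    valuation E ((k : GL (Fin 2) E) i j) ≤ 1 := by
  obtain ⟨g, hg⟩ := k.2.2
  rw [← hg]
  exact (g i j).2

/-- The subgroup `𝒥_d` of `𝒦`: the diagonal entries lie in `1 + 𝔭_E ^ ⌈d/2⌉`, the upper right entry
lies in `𝔭_E ^ ⌈d/2⌉` and the lower left entry in `𝔭_E ^ ⌈(d+1)/2⌉`. -/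
def J (D : UnramifiedData F E) (d : ℕ) : Subgroup D.K where
  carrier := {k | (k : GL (Fin 2) E) 0 0 - 1 ∈ D.pE ((d + 1) / 2 : ℕ) ∧
    (k : GL (Fin 2) E) 0 1 ∈ D.pE ((d + 1) / 2 : ℕ) ∧
    (k : GL (Fin 2) E) 1 0 ∈ D.pE ((d + 2) / 2 : ℕ) ∧
    (k : GL (Fin 2) E) 1 1 - 1 ∈ D.pE ((d + 1) / 2 : ℕ)}
  one_mem' := by simp [pE, idealPow]
  mul_mem' := by
    rintro k l ⟨k1, k2, k3, k4⟩ ⟨l1, l2, l3, l4⟩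
    have h00 : ((k * l : D.K) : GL (Fin 2) E) 0 0 =
        (k : GL (Fin 2) E) 0 0 * (l : GL (Fin 2) E) 0 0 +
        (k : GL (Fin 2) E) 0 1 * (l : GL (Fin 2) E) 1 0 := by
      simp [Matrix.mul_apply, Fin.sum_univ_two]
    have h01 : ((k * l : D.K) : GL (Fin 2) E) 0 1 =
        (k : GL (Fin 2) E) 0 0 * (l : GL (Fin 2) E) 0 1 +
        (k : GL (Fin 2) E) 0 1 * (l : GL (Fin 2) E) 1 1 := by
      simp [Matrix.mul_apply, Fin.sum_univ_two]
    have h10 : ((k * l : D.K) : GL (Fin 2) E) 1 0 =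
        (k : GL (Fin 2) E) 1 0 * (l : GL (Fin 2) E) 0 0 +
        (k : GL (Fin 2) E) 1 1 * (l : GL (Fin 2) E) 1 0 := by
      simp [Matrix.mul_apply, Fin.sum_univ_two]
    have h11 : ((k * l : D.K) : GL (Fin 2) E) 1 1 =
        (k : GL (Fin 2) E) 1 0 * (l : GL (Fin 2) E) 0 1 +
        (k : GL (Fin 2) E) 1 1 * (l : GL (Fin 2) E) 1 1 := by
      simp [Matrix.mul_apply, Fin.sum_univ_two]
    have hk := D.entry_mem k
    have hl := D.entry_mem l
    refine ⟨?_, ?_, ?_, ?_⟩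
    · have e : ((k * l : D.K) : GL (Fin 2) E) 0 0 - 1 =
          ((k : GL (Fin 2) E) 0 0 - 1) * (l : GL (Fin 2) E) 0 0 + ((l : GL (Fin 2) E) 0 0 - 1) +
          (k : GL (Fin 2) E) 0 1 * (l : GL (Fin 2) E) 1 0 := by rw [h00]; ring
      rw [e]
      exact idealPow_add (idealPow_add (idealPow_mul k1 (hl 0 0)) l1) (idealPow_mul k2 (hl 1 0))
    · rw [h01, mul_comm]
      exact idealPow_add (idealPow_mul l2 (hk 0 0)) (idealPow_mul k2 (hl 1 1))
    · rw [h10, mul_comm ((k : GL (Fin 2) E) 1 1)]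
      exact idealPow_add (idealPow_mul k3 (hl 0 0)) (idealPow_mul l3 (hk 1 1))
    · have e : ((k * l : D.K) : GL (Fin 2) E) 1 1 - 1 =
          (l : GL (Fin 2) E) 0 1 * (k : GL (Fin 2) E) 1 0 + (((k : GL (Fin 2) E) 1 1 - 1) *
          (l : GL (Fin 2) E) 1 1 + ((l : GL (Fin 2) E) 1 1 - 1)) := by rw [h11]; ring
      rw [e]
      exact idealPow_add (idealPow_mul l2 (hk 1 0)) (idealPow_add (idealPow_mul k4 (hl 1 1)) l4)
  inv_mem' := by
    rintro k ⟨k1, k2, k3, k4⟩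
    have hi := D.entry_mem k⁻¹
    have hM : ((k⁻¹ : D.K) : GL (Fin 2) E).1 * (k : GL (Fin 2) E).1 = 1 := by
      rw [← Units.val_mul, ← Subgroup.coe_mul, inv_mul_cancel, Subgroup.coe_one, Units.val_one]
    have h00 := congrFun (congrFun hM 0) 0
    have h01 := congrFun (congrFun hM 0) 1
    have h10 := congrFun (congrFun hM 1) 0
    have h11 := congrFun (congrFun hM 1) 1
    simp only [Matrix.mul_apply, Fin.sum_univ_two, Matrix.one_apply_eq, ne_eq, zero_ne_one,
      one_ne_zero, not_false_eq_true, Matrix.one_apply_ne] at h00 h01 h10 h11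
    refine ⟨?_, ?_, ?_, ?_⟩
    · have e : ((k⁻¹ : D.K) : GL (Fin 2) E) 0 0 - 1 =
          ((k : GL (Fin 2) E) 0 0 - 1) * -((k⁻¹ : D.K) : GL (Fin 2) E) 0 0 +
          (k : GL (Fin 2) E) 1 0 * -((k⁻¹ : D.K) : GL (Fin 2) E) 0 1 := by
        linear_combination h00
      rw [e]
      refine idealPow_add (idealPow_mul k1 ?_) (idealPow_mul (D.pE_anti (by omega) k3) ?_)
      · rw [Valuation.map_neg]; exact hi 0 0
      · rw [Valuation.map_neg]; exact hi 0 1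
    · have e : ((k⁻¹ : D.K) : GL (Fin 2) E) 0 1 =
          (k : GL (Fin 2) E) 0 1 * -((k⁻¹ : D.K) : GL (Fin 2) E) 0 0 +
          ((k : GL (Fin 2) E) 1 1 - 1) * -((k⁻¹ : D.K) : GL (Fin 2) E) 0 1 := by
        linear_combination h01
      rw [e]
      refine idealPow_add (idealPow_mul k2 ?_) (idealPow_mul k4 ?_)
      · rw [Valuation.map_neg]; exact hi 0 0
      · rw [Valuation.map_neg]; exact hi 0 1
    · have e : ((k⁻¹ : D.K) : GL (Fin 2) E) 1 0 = (k : GL (Fin 2) E) 1 0 *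
          -(((k⁻¹ : D.K) : GL (Fin 2) E) 0 0 * ((k⁻¹ : D.K) : GL (Fin 2) E) 1 1 -
          ((k⁻¹ : D.K) : GL (Fin 2) E) 0 1 * ((k⁻¹ : D.K) : GL (Fin 2) E) 1 0) := by
        linear_combination -((k⁻¹ : D.K) : GL (Fin 2) E) 1 0 * h00 +
          ((k⁻¹ : D.K) : GL (Fin 2) E) 0 0 * h10
      rw [e]
      refine idealPow_mul k3 ?_
      rw [Valuation.map_neg]
      refine (Valuation.map_sub _ _ _).trans (max_le ?_ ?_)
      · rw [map_mul]; exact mul_le_one' (hi 0 0) (hi 1 1)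
      · rw [map_mul]; exact mul_le_one' (hi 0 1) (hi 1 0)
    · have e : ((k⁻¹ : D.K) : GL (Fin 2) E) 1 1 - 1 =
          (k : GL (Fin 2) E) 0 1 * -((k⁻¹ : D.K) : GL (Fin 2) E) 1 0 +
          ((k : GL (Fin 2) E) 1 1 - 1) * -((k⁻¹ : D.K) : GL (Fin 2) E) 1 1 := by
        linear_combination h11
      rw [e]
      refine idealPow_add (idealPow_mul k2 ?_) (idealPow_mul k4 ?_)
      · rw [Valuation.map_neg]; exact hi 1 0
      · rw [Valuation.map_neg]; exact hi 1 1

/-- `Ψ` is a character of `T(X) 𝒥_d` that extends the given character `ζ` of `T(X)` and the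
function `k ↦ Ψ_X(k) = ψ (Tr (X (k - I)))` on `𝒥_d`.  There is at most one such `Ψ`. -/
def IsExtension (D : UnramifiedData F E) (d : ℕ) (X : Matrix (Fin 2) (Fin 2) E)
    (ζ : D.cent X →* ℂˣ) (Ψ : ↥(D.cent X ⊔ D.J d) →* ℂˣ) : Prop :=
  (∀ k : D.cent X, Ψ (Subgroup.inclusion le_sup_left k) = ζ k) ∧
  ∀ j : D.J d, (Ψ (Subgroup.inclusion le_sup_right j) : ℂ) =
    D.ψ (Matrix.trace (X * ((((j : D.K) : GL (Fin 2) E) : Matrix (Fin 2) (Fin 2) E) - 1)))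

/-- The pair `(X, ζ)` defines a character `Ψ_{X,ζ}` of `T(X) 𝒥_d`, so that `S_d(X, ζ)` exists. -/
def Admissible (D : UnramifiedData F E) (d : ℕ) (X : Matrix (Fin 2) (Fin 2) E)
    (ζ : D.cent X →* ℂˣ) : Prop :=
  ∃ Ψ, D.IsExtension d X ζ Ψ

theorem IsExtension.unique {D : UnramifiedData F E} {d : ℕ} {X : Matrix (Fin 2) (Fin 2) E}
    {ζ : D.cent X →* ℂˣ} {Ψ Ψ' : ↥(D.cent X ⊔ D.J d) →* ℂˣ}
    (h : D.IsExtension d X ζ Ψ) (h' : D.IsExtension d X ζ Ψ') : Ψ = Ψ' := by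
  have key : ∀ k (hk : k ∈ D.cent X ⊔ D.J d), Ψ ⟨k, hk⟩ = Ψ' ⟨k, hk⟩ := by
    intro k hk
    rw [Subgroup.sup_eq_closure] at hk
    induction hk using Subgroup.closure_induction with
    | mem x hx =>
      rcases hx with hx | hx
      · exact (h.1 ⟨x, hx⟩).trans (h'.1 ⟨x, hx⟩).symm
      · exact Units.ext ((h.2 ⟨x, hx⟩).trans (h'.2 ⟨x, hx⟩).symm)
    | one => exact (map_one Ψ).trans (map_one Ψ').symm
    | mul x y hx hy ihx ihy =>
      rw [← Subgroup.sup_eq_closure] at hx hy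
      have e := map_mul Ψ ⟨x, hx⟩ ⟨y, hy⟩
      have e' := map_mul Ψ' ⟨x, hx⟩ ⟨y, hy⟩
      rw [ihx hx, ihy hy, ← e'] at e
      exact e
    | inv x hx ihx =>
      rw [← Subgroup.sup_eq_closure] at hx
      have e := map_inv Ψ ⟨x, hx⟩
      have e' := map_inv Ψ' ⟨x, hx⟩
      rw [ihx hx, ← e'] at e
      exact e
  ext1 ⟨k, hk⟩
  exact key k hk

/-- The character `Ψ_{X,ζ}` of `T(X) 𝒥_d` that extends `ζ` and `Ψ_X`. -/
def Admissible.char {D : UnramifiedData F E} {d : ℕ} {X : Matrix (Fin 2) (Fin 2) E}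
    {ζ : D.cent X →* ℂˣ} (h : D.Admissible d X ζ) : ↥(D.cent X ⊔ D.J d) →* ℂˣ :=
  h.choose

/-- The representation `S_d(X, ζ) = Ind_{T(X) 𝒥_d}^𝒦 Ψ_{X,ζ}` of `𝒦`. -/
def Sd {D : UnramifiedData F E} {d : ℕ} {X : Matrix (Fin 2) (Fin 2) E}
    {ζ : D.cent X →* ℂˣ} (h : D.Admissible d X ζ) :
    Representation ℂ D.K (indSpace (D.cent X ⊔ D.J d) h.char) :=
  indRep (D.cent X ⊔ D.J d) h.char

theorem two_ne_zero_E (D : UnramifiedData F E) : (2 : E) ≠ 0 := by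
  intro h
  have h1 : (2 : F) = 0 := by
    apply (algebraMap F E).injective
    rw [map_ofNat, map_zero, h]
  have h2 : (2 : 𝒪[F]) = 0 := Subtype.ext h1
  have h3 : (2 : 𝓀[F]) = 0 := by
    have := congrArg (algebraMap 𝒪[F] 𝓀[F]) h2
    rwa [map_ofNat, map_zero] at this
  exact Ring.two_ne_zero D.residueChar_ne_two h3

theorem sqrtε_ne_zero (D : UnramifiedData F E) : D.sqrtε ≠ 0 := by
  intro h
  have h1 := D.sqrtε_sq
  rw [h, zero_pow two_ne_zero, eq_comm, map_eq_zero] at h1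
  exact D.ε_nonsquare (h1 ▸ IsSquare.zero)

theorem σ_sqrtε (D : UnramifiedData F E) : D.σ D.sqrtε = - D.sqrtε := by
  have h : D.σ D.sqrtε ^ 2 = D.sqrtε ^ 2 := by
    rw [← map_pow, D.sqrtε_sq, AlgEquiv.commutes]
  rcases sq_eq_sq_iff_eq_or_eq_neg.1 h with h | h
  · exfalso
    apply D.σ_ne_one
    have h2 : (D.σ : E →ₐ[F] E) = AlgHom.id F E := by
      refine AlgHom.ext_of_adjoin_eq_top D.adjoin_sqrtε ?_
      rintro y rfl
      simpa using h
    ext y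
    exact DFunLike.congr_fun h2 y
  · exact h

theorem σ_σ (D : UnramifiedData F E) (x : E) : D.σ (D.σ x) = x := by
  have h2 : ((D.σ : E →ₐ[F] E).comp (D.σ : E →ₐ[F] E)) = AlgHom.id F E := by
    refine AlgHom.ext_of_adjoin_eq_top D.adjoin_sqrtε ?_
    rintro y rfl
    simp [σ_sqrtε]
  exact DFunLike.congr_fun h2 x

/-! ### The pair attached to a nilpotent element -/

/-- The nilpotent matrix `X_δ` with upper right entry `δ √ε`. -/
def nilp (D : UnramifiedData F E) (δ : F) : Matrix (Fin 2) (Fin 2) E :=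
  !![0, algebraMap F E δ * D.sqrtε; 0, 0]

theorem cent_nilp (D : UnramifiedData F E) {δ : F} (hδ : δ ≠ 0) (k : D.cent (D.nilp δ)) :
    ((k : D.K) : GL (Fin 2) E) 1 0 = 0 ∧ ((k : D.K) : GL (Fin 2) E) 0 0 ≠ 0 ∧
      D.σ (((k : D.K) : GL (Fin 2) E) 0 0) * ((k : D.K) : GL (Fin 2) E) 0 0 = 1 := by
  have hs : algebraMap F E δ * D.sqrtε ≠ 0 :=
    mul_ne_zero (by rwa [Ne, map_eq_zero]) D.sqrtε_ne_zero
  obtain ⟨⟨g, hg⟩, h⟩ := k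
  have h : (g : Matrix (Fin 2) (Fin 2) E) * D.nilp δ = D.nilp δ * (g : Matrix (Fin 2) (Fin 2) E) := h
  have h00 := congrFun (congrFun h 0) 0
  have h01 := congrFun (congrFun h 0) 1
  simp [nilp, Matrix.mul_apply, Fin.sum_univ_two, -mul_eq_zero, -zero_eq_mul] at h00 h01
  have e10 : g 1 0 = 0 := (mul_eq_zero.1 h00.symm).resolve_left hs
  have e11 : g 1 1 = g 0 0 := mul_left_cancel₀ hs (by linear_combination -h01)
  have hw : ((g : Matrix (Fin 2) (Fin 2) E).map D.σ)ᵀ * w * (g : Matrix (Fin 2) (Fin 2) E) = w :=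
    hg.1
  have hw01 := congrFun (congrFun hw 0) 1
  simp [w, Matrix.mul_apply, Fin.sum_univ_two, e10, e11] at hw01
  refine ⟨e10, ?_, hw01⟩
  intro h0
  change g 0 0 = 0 at h0
  simp [h0] at hw01

/-- For `δ ≠ 0`, the projection of `T(X_δ) = Z 𝒰` to `Z` with kernel `𝒰`, the group of the
unipotent upper triangular matrices in `𝒦`. -/
def nilpProj (D : UnramifiedData F E) {δ : F} (hδ : δ ≠ 0) : D.cent (D.nilp δ) →* D.Z where
  toFun k := ⟨GeneralLinearGroup.scalar (Fin 2)
      (Units.mk0 (((k : D.K) : GL (Fin 2) E) 0 0) (D.cent_nilp hδ k).2.1),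
    (D.scalar_mem_G_iff _).2 (D.cent_nilp hδ k).2.2, _, rfl⟩
  map_one' := by
    ext i j
    fin_cases i <;> fin_cases j <;> simp [GeneralLinearGroup.scalar]
  map_mul' k l := by
    have h := (D.cent_nilp hδ l).1
    ext i j
    fin_cases i <;> fin_cases j <;>
      simp [GeneralLinearGroup.scalar, Matrix.mul_apply, Fin.sum_univ_two, h]

/-- The character of `T(X_δ) = Z 𝒰` that extends the character `θ` of `Z` and is trivial
on `𝒰`. -/
def nilpChar (D : UnramifiedData F E) {δ : F} (hδ : δ ≠ 0) (θ : D.Z →* ℂˣ) :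
    D.cent (D.nilp δ) →* ℂˣ :=
  θ.comp (D.nilpProj hδ)

theorem ϖ_pow_ne_zero (D : UnramifiedData F E) (d : ℕ) : (D.ϖ : F) ^ (-(d : ℤ)) ≠ 0 := by
  refine zpow_ne_zero _ fun h => D.ϖ_uniformiser.ne_zero ?_
  exact Subtype.ext h

/-! ### The pair attached to a character of positive depth -/

/-- The matrix `Γ = diag(x, - σ x)`. -/
def Γ (D : UnramifiedData F E) (x : E) : Matrix (Fin 2) (Fin 2) E := !![x, 0; 0, - D.σ x]

/-- The matrix `Γ = diag(x, - σ x)` with `x ∈ 𝔭_E ^ (-r)` realizes `χ` on `T_{(r/2)+}`, which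
is `T_n` for `n = ⌊r/2⌋ + 1`: there `χ(t) = ψ (Tr (Γ (t - I)))`. -/
def Realizes (D : UnramifiedData F E) (χ : D.T →* ℂˣ) (r : ℕ) (x : E) : Prop :=
  x ∈ D.pE (-(r : ℤ)) ∧
  ∀ t ∈ D.Tfil (r / 2 + 1), (χ t : ℂ) =
    D.ψ (Matrix.trace (D.Γ x * (((t : GL (Fin 2) E) : Matrix (Fin 2) (Fin 2) E) - 1)))

theorem Realizes.ne_zero {D : UnramifiedData F E} {χ : D.T →* ℂˣ} {r : ℕ} {x : E}
    (h : D.Realizes χ r x) (hr : 0 < r) (hχ : D.HasMinimalDepth χ r) : x + D.σ x ≠ 0 := by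
  intro hx
  rcases hχ.2.1 with h0 | ⟨_, ⟨b, ⟨hb1, hb2⟩, rfl⟩, hb⟩
  · omega
  apply hb
  have hϖ : valuation F (D.ϖ : F) ≤ 1 := D.ϖ.2
  have hϖ0 : (D.ϖ : F) ≠ 0 := fun h => D.ϖ_uniformiser.ne_zero (Subtype.ext h)
  have hmem : D.t (Units.map (algebraMap F E : F →* E) b) ∈ D.Tfil (r / 2 + 1) := by
    refine ⟨_, ⟨?_, ?_⟩, rfl⟩
    · have h1 : valuation F (b : F) ≤ valuation F 1 := by rw [hb1, map_one]
      have h2 : valuation F 1 ≤ valuation F (b : F) := by rw [hb1, map_one]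
      rw [← (valuation F).vle_iff_le, ← ValuativeExtension.vle_iff_vle (B := E),
        (valuation E).vle_iff_le] at h1 h2
      simpa using le_antisymm h1 h2
    · have h1 : valuation F ((b : F) - 1) ≤ valuation F ((D.ϖ : F) ^ (r / 2 + 1)) := by
        have h3 : valuation F ((b : F) - 1) ≤ valuation F (D.ϖ : F) ^ r := by
          simpa [idealPow] using hb2
        rw [map_pow]
        exact h3.trans (pow_le_pow_right_of_le_one' hϖ (by omega))
      rw [← (valuation F).vle_iff_le, ← ValuativeExtension.vle_iff_vle (B := E),
        (valuation E).vle_iff_le] at h1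
      simp only [idealPow, Set.mem_ofPred_eq, zpow_natCast]
      simpa using h1
  have key := h.2 _ hmem
  have hσ : D.σ x = - x := by linear_combination hx
  apply Units.ext
  rw [key]
  have htr : Matrix.trace (D.Γ x * ((((D.t (Units.map (algebraMap F E : F →* E) b) : D.T) :
      GL (Fin 2) E) : Matrix (Fin 2) (Fin 2) E) - 1)) =
      (algebraMap F E ((b : F) - 1 + ((b : F)⁻¹ - 1))) * x := by
    rw [show (D.t (Units.map (algebraMap F E : F →* E) b) : GL (Fin 2) E) =
      D.tor (Units.map (algebraMap F E : F →* E) b) from rfl, tor_val]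
    simp only [Γ, Matrix.trace_fin_two, Matrix.mul_apply, Fin.sum_univ_two, hσ]
    simp
    ring
  have htr2 : Algebra.trace F E x = 0 := by
    have h2 : Algebra.trace F E (D.σ x) = Algebra.trace F E x :=
      Algebra.trace_eq_of_algEquiv D.σ x
    rw [hσ, map_neg] at h2
    have h4 : (2 : F) ≠ 0 := fun h => D.two_ne_zero_E (by
      have := congrArg (algebraMap F E) h
      rwa [map_ofNat, map_zero] at this)
    have h3 : (2 : F) * Algebra.trace F E x = 0 := by linear_combination -h2
    exact (mul_eq_zero.1 h3).resolve_left h4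
  rw [htr, ψ, ← Algebra.smul_def, map_smul, htr2]
  simp

/-- The element `γ = (x + σ x) ϖ ^ d √ε / 2` of `E`. -/
def γ (D : UnramifiedData F E) (x : E) (d : ℕ) : E :=
  (x + D.σ x) * algebraMap F E D.ϖ ^ d * D.sqrtε / 2

theorem γ_ne_zero (D : UnramifiedData F E) {x : E} (hx : x + D.σ x ≠ 0) (d : ℕ) :
    D.γ x d ≠ 0 := by
  refine div_ne_zero (mul_ne_zero (mul_ne_zero hx (pow_ne_zero _ ?_)) D.sqrtε_ne_zero)
    D.two_ne_zero_E
  rw [Ne, map_eq_zero]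
  exact fun h => D.ϖ_uniformiser.ne_zero (Subtype.ext h)

theorem σ_γ (D : UnramifiedData F E) (x : E) (d : ℕ) : D.σ (D.γ x d) = - D.γ x d := by
  simp only [γ, map_mul, map_div₀, map_add, map_pow, D.σ_σ, D.σ_sqrtε, AlgEquiv.commutes,
    map_ofNat]
  ring

/-- The element `g_d` with rows `(1, - γ⁻¹ / 2)` and `(γ, 1 / 2)`. -/
def gd (D : UnramifiedData F E) {x : E} (hx : x + D.σ x ≠ 0) (d : ℕ) : GL (Fin 2) E :=
  GeneralLinearGroup.mkOfDetNeZero !![1, -(D.γ x d)⁻¹ / 2; D.γ x d, 1 / 2] (by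
    have h1 := D.γ_ne_zero hx d
    have h2 := D.two_ne_zero_E
    rw [Matrix.det_fin_two_of]
    have h3 : (1 : E) * (1 / 2) - -(D.γ x d)⁻¹ / 2 * D.γ x d = 1 := by
      field_simp
      ring
    rw [h3]
    exact one_ne_zero)

theorem gd_mem (D : UnramifiedData F E) {x : E} (hx : x + D.σ x ≠ 0) (d : ℕ) :
    D.gd hx d ∈ D.G := by
  have h1 := D.γ_ne_zero hx d
  have h2 := D.two_ne_zero_E
  change (((D.gd hx d : GL (Fin 2) E) :
    Matrix (Fin 2) (Fin 2) E).map D.σ)ᵀ * w * _ = w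
  ext i j
  fin_cases i <;> fin_cases j <;>
    simp [w, gd, Matrix.mul_apply, Fin.sum_univ_two, GeneralLinearGroup.mkOfDetNeZero, D.σ_γ] <;>
    field_simp <;> norm_num [map_ofNat D.σ 2, h2]

/-- The element `Y_χ = g_d Γ g_d⁻¹`. -/
def Y (D : UnramifiedData F E) {x : E} (hx : x + D.σ x ≠ 0) (d : ℕ) :
    Matrix (Fin 2) (Fin 2) E :=
  (D.gd hx d : Matrix (Fin 2) (Fin 2) E) * D.Γ x *
    (((D.gd hx d)⁻¹ : GL (Fin 2) E) : Matrix (Fin 2) (Fin 2) E)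

theorem mem_T_of_commute (D : UnramifiedData F E) {x : E} (hx : x + D.σ x ≠ 0)
    {g : GL (Fin 2) E} (hg : g ∈ D.G)
    (h : (g : Matrix (Fin 2) (Fin 2) E) * D.Γ x = D.Γ x * (g : Matrix (Fin 2) (Fin 2) E)) :
    g ∈ D.T := by
  have h01 := congrFun (congrFun h 0) 1
  have h10 := congrFun (congrFun h 1) 0
  simp [Γ, Matrix.mul_apply, Fin.sum_univ_two] at h01 h10
  have e01 : g 0 1 = 0 := by
    have : (x + D.σ x) * g 0 1 = 0 := by linear_combination -h01
    exact (mul_eq_zero.1 this).resolve_left hx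
  have e10 : g 1 0 = 0 := by
    have : (x + D.σ x) * g 1 0 = 0 := by linear_combination h10
    exact (mul_eq_zero.1 this).resolve_left hx
  have hw : ((g : Matrix (Fin 2) (Fin 2) E).map D.σ)ᵀ * w * (g : Matrix (Fin 2) (Fin 2) E) = w := hg
  have hw01 := congrFun (congrFun hw 0) 1
  simp [w, Matrix.mul_apply, Fin.sum_univ_two, e01, e10] at hw01
  have ne : g 0 0 ≠ 0 := by
    intro h0
    simp [h0] at hw01
  refine ⟨Units.mk0 _ ne, ?_⟩
  have e11 : (D.σ (g 0 0))⁻¹ = g 1 1 := inv_eq_of_mul_eq_one_right hw01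
  ext i j
  fin_cases i <;> fin_cases j <;> simp [tor, GeneralLinearGroup.mkOfDetNeZero, e01, e10, e11]

theorem commute_conj_aux {M : Type*} [Monoid M] {a b c g : M} (h2 : b * a = 1)
    (h : c * (a * g * b) = a * g * b * c) : b * c * a * g = g * (b * c * a) := by
  have h3 : b * (c * (a * g * b)) * a = b * (a * g * b * c) * a := by rw [h]
  have e1 : b * (c * (a * g * b)) * a = b * c * a * g * (b * a) := by simp only [mul_assoc]
  have e2 : b * (a * g * b * c) * a = (b * a) * g * (b * c * a) := by simp only [mul_assoc]
  rw [e1, e2, h2, one_mul, mul_one] at h3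
  exact h3

theorem conj_mem_T (D : UnramifiedData F E) {x : E} (hx : x + D.σ x ≠ 0) (d : ℕ)
    (k : D.cent (D.Y hx d)) :
    (D.gd hx d)⁻¹ * ((k : D.K) : GL (Fin 2) E) * D.gd hx d ∈ D.T := by
  have hG : (D.gd hx d)⁻¹ * ((k : D.K) : GL (Fin 2) E) * D.gd hx d ∈ D.G :=
    mul_mem (mul_mem (inv_mem (D.gd_mem hx d)) k.1.2.1) (D.gd_mem hx d)
  have hk : (((k : D.K) : GL (Fin 2) E) : Matrix (Fin 2) (Fin 2) E) * D.Y hx d =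
    D.Y hx d * (((k : D.K) : GL (Fin 2) E) : Matrix (Fin 2) (Fin 2) E) := k.2
  refine D.mem_T_of_commute hx hG ?_
  simp only [Units.val_mul]
  refine commute_conj_aux ?_ hk
  rw [← Units.val_mul, inv_mul_cancel, Units.val_one]

/-- The character `ζ_χ = χ^{g_d}` of `T(Y_χ)`, given by `k ↦ χ (g_d⁻¹ k g_d)`. -/
def zeta (D : UnramifiedData F E) (χ : D.T →* ℂˣ) {x : E} (hx : x + D.σ x ≠ 0) (d : ℕ) :
    D.cent (D.Y hx d) →* ℂˣ where
  toFun k := χ ⟨_, D.conj_mem_T hx d k⟩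
  map_one' := by
    rw [← map_one χ]
    congr 1
    ext1
    simp
  map_mul' a b := by
    rw [← map_mul]
    congr 1
    ext1
    simp [mul_assoc]

end UnramifiedData

end

open ValuativeRel Matrix

noncomputable section

set_option linter.unusedSectionVars false

/-! ### Square roots by Hensel's lemma -/

section LocalField

variable {L : Type*} [Field L] [ValuativeRel L] [TopologicalSpace L] [IsNonarchimedeanLocalField L]

/-! Both representations are induced from the same subgroup `H` of 𝒦, by characters of the same
shape that are conjugate to each other under a diagonal element.

The group `H` = Z 𝒰 𝒥_d consists of the k whose diagonal entries are congruent to one z ∈ Z modulo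
𝔭^⌈d/2⌉ and whose lower left entry lies in 𝔭^⌈(d+1)/2⌉. For θ of depth zero and δ ∈ 𝔭^(-d), the
formula k ↦ θ(z) ψ(δ √ε z⁻¹ k₂₁) is a character of `H` (`charFun_eq`, `charHom`): every error term
lies in 𝔭, because ⌈d/2⌉ + ⌈(d+1)/2⌉ = d + 1.

For X_δ one has T(X_δ) = Z 𝒰, and this character is visibly the required extension. For Y_χ the
hypothesis d > 2r enters three times. An integral element of g_d T g_d⁻¹ comes from t(α) with α so
close to norm one that α ≡ z modulo 𝔭^(d-r) for some z ∈ Z, and χ does not distinguish α from z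
since d - r ≥ r + 1 (`cent_Y_isNear`). Conversely, T(Y_χ) contains approximations to all of Z 𝒰, so
that T(Y_χ) 𝒥_d = `H` as well (`cent_Y_sup_J`). Finally, only the upper right entry of Y_χ matters
on 𝒥_d, and it equals ϖ^(-d) ε⁻¹ √ε by the choice of γ (`ψ_trace_Y`).

So the two characters have parameters δ = ϖ^(-d) and δ = ϖ^(-d) ε⁻¹. The unit ε⁻¹ is a norm c σ(c)
from E (`exists_norm_eq_inv_ε`), and conjugation by t(c) exchanges them (`exists_conj_charHom`);
conjugate characters induce isomorphic representations. Part 3 follows since the nilpotent side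
knows only θ.

The existence of Γ is a duality statement: χ is additive on T_n for n = ⌊r/2⌋ + 1 modulo T_(r+1),
and ψ identifies 𝒪_E / 𝔭_E^N with its own dual group (`exists_eq_ψ`). -/

theorem mem_maximalIdeal_iff_valuation_lt_one (y : 𝒪[L]) :
    y ∈ 𝓂[L] ↔ valuation L (y : L) < 1 := by
  rw [IsLocalRing.mem_maximalIdeal, mem_nonunits_iff,
    (Valuation.integer.integers (valuation L)).isUnit_iff_valuation_eq_one]
  exact (lt_iff_le_and_ne.trans (and_iff_right y.2)).symm

/-- A unit that is a square modulo the maximal ideal is a square. -/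
theorem isSquare_of_valuation_sub_sq_lt_one (h2 : valuation L (2 : L) = 1) {a c : L}
    (ha : valuation L a ≤ 1) (hc : valuation L c = 1)
    (h : valuation L (c ^ 2 - a) < 1) : IsSquare a := by
  let := IsTopologicalAddGroup.rightUniformSpace L
  have := isUniformAddGroup_of_addCommGroup (G := L)
  have hh : HenselianRing 𝒪[L] 𝓂[L] := inferInstance
  let a' : 𝒪[L] := ⟨a, ha⟩
  let c' : 𝒪[L] := ⟨c, hc.le⟩
  -- Hensel's lemma for X² - a at the approximate root c, where the derivative 2c is a unit.
  obtain ⟨y, hy, -⟩ := hh.is_henselian (Polynomial.X ^ 2 - Polynomial.C a')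
    (Polynomial.monic_X_pow_sub_C _ two_ne_zero) c' (by
      rw [mem_maximalIdeal_iff_valuation_lt_one]
      simpa [a', c'] using h) (by
      refine IsUnit.map _ ?_
      rw [(Valuation.integer.integers (valuation L)).isUnit_iff_valuation_eq_one]
      have e : Polynomial.eval c' (Polynomial.derivative
          (Polynomial.X ^ 2 - Polynomial.C a')) = 2 * c' := by
        simp [one_add_one_eq_two]
      rw [e, map_mul, map_mul]
      change valuation L (2 : L) * valuation L c = 1
      rw [h2, hc, one_mul])
  refine ⟨y, ?_⟩
  have h3 : y ^ 2 - a' = 0 := by simpa [Polynomial.IsRoot] using hy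
  have h4 := congrArg (Subtype.val) h3
  simp [a'] at h4
  linear_combination -h4

end LocalField

/-! ### The valuation of E in the coordinates 1, √ε -/

namespace UnramifiedData

variable {F E : Type*}
  [Field F] [ValuativeRel F] [TopologicalSpace F] [IsNonarchimedeanLocalField F]
  [Field E] [ValuativeRel E] [TopologicalSpace E] [IsNonarchimedeanLocalField E]
  [Algebra F E] [ValuativeExtension F E]

theorem valuation_algebraMap_le_iff {a b : F} :
    valuation E (algebraMap F E a) ≤ valuation E (algebraMap F E b) ↔
      valuation F a ≤ valuation F b := by
  rw [← (valuation E).vle_iff_le, ValuativeExtension.vle_iff_vle, (valuation F).vle_iff_le]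

theorem valuation_algebraMap_lt_iff {a b : F} :
    valuation E (algebraMap F E a) < valuation E (algebraMap F E b) ↔
      valuation F a < valuation F b := by
  rw [← not_le, valuation_algebraMap_le_iff, not_le]

theorem valuation_algebraMap_le_one_iff {a : F} :
    valuation E (algebraMap F E a) ≤ 1 ↔ valuation F a ≤ 1 := by
  simpa using valuation_algebraMap_le_iff (E := E) (a := a) (b := 1)

theorem valuation_algebraMap_lt_one_iff {a : F} :
    valuation E (algebraMap F E a) < 1 ↔ valuation F a < 1 := by
  simpa using valuation_algebraMap_lt_iff (E := E) (a := a) (b := 1)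

theorem valuation_algebraMap_eq_one_iff {a : F} :
    valuation E (algebraMap F E a) = 1 ↔ valuation F a = 1 := by
  rw [eq_iff_le_not_lt, eq_iff_le_not_lt, valuation_algebraMap_le_one_iff,
    valuation_algebraMap_lt_one_iff]

theorem valuation_two_F (D : UnramifiedData F E) : valuation F (2 : F) = 1 := by
  have h3 : (2 : 𝓀[F]) ≠ 0 := Ring.two_ne_zero D.residueChar_ne_two
  have h : (2 : 𝒪[F]) ∉ 𝓂[F] := fun h => h3 (by
    have := (IsLocalRing.residue_eq_zero_iff (2 : 𝒪[F])).2 h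
    rwa [map_ofNat] at this)
  rw [mem_maximalIdeal_iff_valuation_lt_one, not_lt] at h
  exact le_antisymm (2 : 𝒪[F]).2 h

theorem valuation_two (D : UnramifiedData F E) : valuation E (2 : E) = 1 := by
  have := valuation_algebraMap_eq_one_iff (E := E).2 D.valuation_two_F
  rwa [map_ofNat] at this

theorem valuation_sqrtε (D : UnramifiedData F E) : valuation E D.sqrtε = 1 := by
  have h : valuation E D.sqrtε ^ 2 = 1 := by
    rw [← map_pow, D.sqrtε_sq]
    exact valuation_algebraMap_eq_one_iff.2 D.ε_unit
  exact (pow_eq_one_iff_of_nonneg (zero_le) two_ne_zero).1 h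

theorem exists_eq_add_mul_sqrtε (D : UnramifiedData F E) (x : E) :
    ∃ a b : F, x = algebraMap F E a + algebraMap F E b * D.sqrtε := by
  have hx : x ∈ Algebra.adjoin F {D.sqrtε} := by rw [D.adjoin_sqrtε]; trivial
  induction hx using Algebra.adjoin_induction with
  | mem x hx => exact ⟨0, 1, by simpa using hx⟩
  | algebraMap r => exact ⟨r, 0, by simp⟩
  | add x y _ _ hx hy =>
    obtain ⟨a, b, rfl⟩ := hx
    obtain ⟨c, d, rfl⟩ := hy
    exact ⟨a + c, b + d, by simp only [map_add]; ring⟩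
  | mul x y _ _ hx hy =>
    obtain ⟨a, b, rfl⟩ := hx
    obtain ⟨c, d, rfl⟩ := hy
    refine ⟨a * c + b * d * D.ε, a * d + b * c, ?_⟩
    simp only [map_add, map_mul, ← D.sqrtε_sq]
    ring

/-- If c² were congruent to ε modulo 𝔭_F, Hensel's lemma would make ε a square. This is the source
of everything that is unramified about E. -/
theorem valuation_sq_sub_ε (D : UnramifiedData F E) {c : F} (hc : valuation F c ≤ 1) :
    valuation F (c ^ 2 - D.ε) = 1 := by
  have hle : valuation F (c ^ 2 - D.ε) ≤ 1 :=
    ((valuation F).map_sub _ _).trans (max_le (by rw [map_pow]; exact pow_le_one' hc 2)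
      D.ε_unit.le)
  refine hle.eq_of_not_lt fun h => D.ε_nonsquare ?_
  refine isSquare_of_valuation_sub_sq_lt_one D.valuation_two_F D.ε_unit.le ?_ h
  have h1 : valuation F (c ^ 2) = 1 := by
    have := Valuation.map_add_eq_of_lt_right (v := valuation F) (x := c ^ 2 - D.ε) (y := D.ε)
      (by rwa [D.ε_unit])
    rwa [sub_add_cancel, D.ε_unit] at this
  rw [map_pow] at h1
  exact (pow_eq_one_iff_of_nonneg (zero_le) two_ne_zero).1 h1

/-- The norm form of `E` over `F` is as large as it can be. -/
theorem valuation_norm_form (D : UnramifiedData F E) (a b : F) :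
    valuation F a ^ 2 ≤ valuation F (a ^ 2 - D.ε * b ^ 2) ∧
      valuation F b ^ 2 ≤ valuation F (a ^ 2 - D.ε * b ^ 2) := by
  rcases lt_or_ge (valuation F b) (valuation F a) with h | h
  · have h1 : valuation F (D.ε * b ^ 2) < valuation F (a ^ 2) := by
      rw [map_mul, D.ε_unit, one_mul, map_pow, map_pow]
      exact pow_lt_pow_left₀ h (zero_le) two_ne_zero
    rw [Valuation.map_sub_eq_of_lt_left _ h1, map_pow]
    exact ⟨le_rfl, pow_le_pow_left' h.le 2⟩
  · by_cases hb : b = 0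
    · subst hb
      have ha : valuation F a = 0 := by simpa using h
      simp [ha]
    -- Now |a| ≤ |b|, and dividing by b² reduces to the integral element a / b.
    have e : a ^ 2 - D.ε * b ^ 2 = ((a / b) ^ 2 - D.ε) * b ^ 2 := by field_simp
    have hb' : 0 < valuation F b := by simpa [zero_lt_iff] using hb
    rw [e, map_mul, D.valuation_sq_sub_ε (by rw [map_div₀]; exact (div_le_one₀ hb').2 h),
      one_mul, map_pow]
    exact ⟨pow_le_pow_left' h 2, le_rfl⟩

theorem mul_σ_eq (D : UnramifiedData F E) (a b : F) :
    (algebraMap F E a + algebraMap F E b * D.sqrtε) *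
      D.σ (algebraMap F E a + algebraMap F E b * D.sqrtε) =
      algebraMap F E (a ^ 2 - D.ε * b ^ 2) := by
  simp only [map_add, map_mul, map_sub, map_pow, AlgEquiv.commutes, D.σ_sqrtε, ← D.sqrtε_sq]
  ring

/-- The integers of `E` are `𝒪_F + 𝒪_F √ε`, and likewise for the other balls. -/
theorem valuation_add_mul_sqrtε (D : UnramifiedData F E) (a b : F) :
    valuation E (algebraMap F E a + algebraMap F E b * D.sqrtε) =
      max (valuation E (algebraMap F E a)) (valuation E (algebraMap F E b)) := by
  have key : ∀ a b : F,
      valuation E (algebraMap F E a + algebraMap F E b * D.sqrtε) ≤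
        max (valuation E (algebraMap F E a)) (valuation E (algebraMap F E b)) := by
    intro a b
    refine ((valuation E).map_add _ _).trans (max_le_max le_rfl ?_)
    rw [map_mul, D.valuation_sqrtε, mul_one]
  -- If the value were smaller than the maximum M, then, its conjugate having value at most M, the
  -- norm would be smaller than M², against `valuation_norm_form`.
  refine le_antisymm (key a b) (not_lt.1 fun h => ?_)
  set M := max (valuation E (algebraMap F E a)) (valuation E (algebraMap F E b)) with hM
  have e : D.σ (algebraMap F E a + algebraMap F E b * D.sqrtε) =
      algebraMap F E a + algebraMap F E (-b) * D.sqrtε := by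
    simp [D.σ_sqrtε]
  have h2 := key a (-b)
  rw [← e, map_neg, Valuation.map_neg, ← hM] at h2
  have h3 := congrArg (valuation E) (D.mul_σ_eq a b)
  rw [map_mul] at h3
  have hM0 : 0 < M := lt_of_le_of_lt (zero_le) h
  have h4 : valuation E (algebraMap F E (a ^ 2 - D.ε * b ^ 2)) < M ^ 2 := by
    rw [← h3, pow_two]
    exact (mul_le_mul_right h2 _).trans_lt (mul_lt_mul_of_pos_right h hM0)
  obtain ⟨h5, h6⟩ := D.valuation_norm_form a b
  rw [← map_pow, ← valuation_algebraMap_le_iff (E := E), map_pow, map_pow] at h5 h6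
  rcases max_choice (valuation E (algebraMap F E a)) (valuation E (algebraMap F E b)) with h7 | h7
  · rw [hM, h7] at h4
    exact absurd h5 (not_le.2 h4)
  · rw [hM, h7] at h4
    exact absurd h6 (not_le.2 h4)

/-- σ changes only the sign of the √ε coordinate, which the maximum formula ignores. -/
theorem valuation_σ (D : UnramifiedData F E) (x : E) :
    valuation E (D.σ x) = valuation E x := by
  obtain ⟨a, b, rfl⟩ := D.exists_eq_add_mul_sqrtε x
  have e : D.σ (algebraMap F E a + algebraMap F E b * D.sqrtε) =
      algebraMap F E a + algebraMap F E (-b) * D.sqrtε := by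
    simp [D.σ_sqrtε]
  rw [e, valuation_add_mul_sqrtε, valuation_add_mul_sqrtε, map_neg, Valuation.map_neg]


theorem valuation_ϖ_lt_one (D : UnramifiedData F E) : valuation F (D.ϖ : F) < 1 := by
  rw [← mem_maximalIdeal_iff_valuation_lt_one, IsLocalRing.mem_maximalIdeal]
  exact D.ϖ_uniformiser.not_isUnit

theorem ϖ_ne_zero (D : UnramifiedData F E) : (D.ϖ : F) ≠ 0 :=
  fun h => D.ϖ_uniformiser.ne_zero (Subtype.ext h)

theorem valuation_algebraMap_ϖ_lt_one (D : UnramifiedData F E) :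
    valuation E (algebraMap F E D.ϖ) < 1 :=
  valuation_algebraMap_lt_one_iff.2 D.valuation_ϖ_lt_one

theorem algebraMap_ϖ_ne_zero (D : UnramifiedData F E) : algebraMap F E D.ϖ ≠ 0 := by
  rw [Ne, map_eq_zero]; exact D.ϖ_ne_zero

theorem valuation_algebraMap_ϖ_pos (D : UnramifiedData F E) :
    0 < valuation E (algebraMap F E D.ϖ) := by
  rw [zero_lt_iff, Ne, map_eq_zero]; exact D.algebraMap_ϖ_ne_zero

theorem valuation_le_ϖ (D : UnramifiedData F E) {a : F} (ha : valuation F a < 1) :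
    valuation F a ≤ valuation F (D.ϖ : F) := by
  let a' : 𝒪[F] := ⟨a, ha.le⟩
  have h : a' ∈ 𝓂[F] := (mem_maximalIdeal_iff_valuation_lt_one a').2 ha
  rw [(IsDiscreteValuationRing.irreducible_iff_uniformizer D.ϖ).1 D.ϖ_uniformiser,
    Ideal.mem_span_singleton] at h
  obtain ⟨c, hc⟩ := h
  have h2 : a = D.ϖ * c := congrArg Subtype.val hc
  rw [h2, map_mul]
  exact mul_le_of_le_one_right' c.2

/-- The maximum formula for the valuation shows that 1 and √ε are independent. -/
theorem finrank_eq_two (D : UnramifiedData F E) : Module.finrank F E = 2 := by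
  let f : (F × F) →ₗ[F] E := (Algebra.linearMap F E).coprod (LinearMap.toSpanSingleton F E D.sqrtε)
  have hf (a b : F) : f (a, b) = algebraMap F E a + algebraMap F E b * D.sqrtε := by
    simp [f, Algebra.smul_def]
  have hb : Function.Bijective f := by
    refine ⟨(injective_iff_map_eq_zero f).2 ?_, fun x => ?_⟩
    · rintro ⟨a, b⟩ h
      rw [hf] at h
      have h2 := D.valuation_add_mul_sqrtε a b
      rw [h, map_zero, eq_comm, ← le_zero_iff, max_le_iff] at h2
      simpa using h2
    · obtain ⟨a, b, rfl⟩ := D.exists_eq_add_mul_sqrtε x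
      exact ⟨(a, b), hf a b⟩
  rw [← (LinearEquiv.ofBijective f hb).finrank_eq]
  simp

/-! ### Fractional ideals of E and the character ψ -/

section Ideals

variable (D : UnramifiedData F E)

theorem mem_pE {n : ℤ} {x : E} :
    x ∈ D.pE n ↔ valuation E x ≤ valuation E (algebraMap F E D.ϖ) ^ n := Iff.rfl

theorem mem_pE_zero {x : E} : x ∈ D.pE 0 ↔ valuation E x ≤ 1 := by
  rw [mem_pE, zpow_zero]

theorem pE_le {m n : ℤ} (h : m ≤ n) {x : E} (hx : x ∈ D.pE n) : x ∈ D.pE m :=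
  (D.mem_pE.1 hx).trans
    (zpow_le_zpow_right_of_le_one₀ D.valuation_algebraMap_ϖ_pos
      D.valuation_algebraMap_ϖ_lt_one.le h)

theorem pE_add {n : ℤ} {x y : E} (hx : x ∈ D.pE n) (hy : y ∈ D.pE n) : x + y ∈ D.pE n :=
  idealPow_add hx hy

theorem pE_neg {n : ℤ} {x : E} (hx : x ∈ D.pE n) : -x ∈ D.pE n := by
  rw [mem_pE, Valuation.map_neg]; exact hx

theorem pE_sub {n : ℤ} {x y : E} (hx : x ∈ D.pE n) (hy : y ∈ D.pE n) : x - y ∈ D.pE n := by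
  rw [sub_eq_add_neg]; exact D.pE_add hx (D.pE_neg hy)

theorem pE_mul {m n : ℤ} {x y : E} (hx : x ∈ D.pE m) (hy : y ∈ D.pE n) :
    x * y ∈ D.pE (m + n) := by
  rw [mem_pE, map_mul, zpow_add₀ D.valuation_algebraMap_ϖ_pos.ne']
  exact mul_le_mul' hx hy

theorem pE_mul_right {n : ℤ} {x y : E} (hx : x ∈ D.pE n) (hy : valuation E y ≤ 1) :
    x * y ∈ D.pE n := idealPow_mul hx hy

theorem pE_mul_left {n : ℤ} {x y : E} (hx : valuation E x ≤ 1) (hy : y ∈ D.pE n) :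
    x * y ∈ D.pE n := by
  rw [mul_comm]; exact idealPow_mul hy hx

theorem pE_σ {n : ℤ} {x : E} (hx : x ∈ D.pE n) : D.σ x ∈ D.pE n := by
  rw [mem_pE, D.valuation_σ]; exact hx

theorem zero_mem_pE {n : ℤ} : (0 : E) ∈ D.pE n := by
  rw [mem_pE, map_zero]; exact zero_le

theorem ϖ_zpow_mem_pE (n : ℤ) : algebraMap F E D.ϖ ^ n ∈ D.pE n := by
  rw [mem_pE, map_zpow₀]

theorem pE_div_ϖ_zpow {m n : ℤ} {x : E} (hx : x ∈ D.pE (m + n)) :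
    x / algebraMap F E D.ϖ ^ m ∈ D.pE n := by
  have h := D.pE_mul hx (D.ϖ_zpow_mem_pE (-m))
  rw [_root_.zpow_neg, ← div_eq_mul_inv] at h
  exact D.pE_le (by omega) h

theorem mem_pE_div_two {n : ℤ} {x : E} (hx : x ∈ D.pE n) : x / 2 ∈ D.pE n := by
  rw [mem_pE, map_div₀, D.valuation_two, div_one]; exact hx

/-- Both coordinates of an element of value less than 1 lie in 𝔭_F, where ϖ is a generator. So ϖ
remains a uniformiser in E. -/
theorem mem_pE_one_iff {x : E} : x ∈ D.pE 1 ↔ valuation E x < 1 := by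
  rw [mem_pE, zpow_one]
  refine ⟨fun h => h.trans_lt D.valuation_algebraMap_ϖ_lt_one, fun h => ?_⟩
  obtain ⟨a, b, rfl⟩ := D.exists_eq_add_mul_sqrtε x
  rw [valuation_add_mul_sqrtε] at h ⊢
  obtain ⟨h1, h2⟩ := max_lt_iff.1 h
  rw [valuation_algebraMap_lt_one_iff] at h1 h2
  exact max_le (valuation_algebraMap_le_iff.2 (D.valuation_le_ϖ h1))
    (valuation_algebraMap_le_iff.2 (D.valuation_le_ϖ h2))

/-- `ϖ` is a uniformiser of `E`. -/
theorem mem_pE_succ_iff {n : ℤ} {x : E} :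
    x ∈ D.pE (n + 1) ↔ valuation E x < valuation E (algebraMap F E D.ϖ) ^ n := by
  have hp := zpow_pos D.valuation_algebraMap_ϖ_pos n
  have h : x ∈ D.pE (n + 1) ↔ x / algebraMap F E D.ϖ ^ n ∈ D.pE 1 := by
    refine ⟨D.pE_div_ϖ_zpow, fun h => ?_⟩
    have := D.pE_mul (D.ϖ_zpow_mem_pE n) h
    rwa [mul_div_cancel₀ _ (zpow_ne_zero _ D.algebraMap_ϖ_ne_zero)] at this
  rw [h, mem_pE_one_iff, map_div₀, map_zpow₀, div_lt_one₀ hp]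

theorem valuation_eq_one_of_sub_one_mem {n : ℤ} (hn : 1 ≤ n) {x : E} (hx : x - 1 ∈ D.pE n) :
    valuation E x = 1 := by
  have h : valuation E (x - 1) < 1 := D.mem_pE_one_iff.1 (D.pE_le hn hx)
  have := Valuation.map_add_eq_of_lt_right (v := valuation E) (x := x - 1) (y := 1)
    (by rwa [map_one])
  rwa [sub_add_cancel, map_one] at this

theorem valuation_eq_one_of_norm_eq_one {z : E} (hz : D.σ z * z = 1) : valuation E z = 1 := by
  have h := congrArg (valuation E) hz
  rw [map_mul, D.valuation_σ, map_one, ← pow_two] at h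
  exact (pow_eq_one_iff_of_nonneg (zero_le) two_ne_zero).1 h

/-- The conjugates √ε and -√ε have the same trace, so this trace is zero. -/
theorem algebraMap_trace (x : E) : algebraMap F E (Algebra.trace F E x) = x + D.σ x := by
  have h0 : Algebra.trace F E D.sqrtε = 0 := by
    have h1 := Algebra.trace_eq_of_algEquiv D.σ D.sqrtε
    rw [D.σ_sqrtε, map_neg] at h1
    have h2 : (2 : F) ≠ 0 := fun h => D.two_ne_zero_E (by
      rw [← map_ofNat (algebraMap F E), h, map_zero])
    exact (mul_eq_zero.1 (show 2 * Algebra.trace F E D.sqrtε = 0 by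
      linear_combination -h1)).resolve_left h2
  obtain ⟨a, b, rfl⟩ := D.exists_eq_add_mul_sqrtε x
  rw [map_add, Algebra.trace_algebraMap, D.finrank_eq_two, ← Algebra.smul_def, map_smul, h0,
    smul_zero, add_zero, two_smul, map_add, map_add, map_smul, AlgEquiv.commutes, D.σ_sqrtε,
    smul_neg]
  ring

theorem ψ_add (x y : E) : D.ψ (x + y) = D.ψ x * D.ψ y := by
  rw [ψ, map_add, add_div, AddChar.map_add_eq_mul]; rfl

theorem ψ_zero : D.ψ 0 = 1 := by simp [ψ]

theorem ψ_σ (x : E) : D.ψ (D.σ x) = D.ψ x := by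
  rw [ψ, ψ, Algebra.trace_eq_of_algEquiv D.σ x]

theorem ψ_eq_one {x : E} (hx : x ∈ D.pE 1) : D.ψ x = 1 := by
  have h : valuation F (Algebra.trace F E x / 2) < 1 := by
    rw [← valuation_algebraMap_lt_one_iff (E := E), ← D.mem_pE_one_iff, map_div₀, map_ofNat,
      D.algebraMap_trace]
    exact D.mem_pE_div_two (D.pE_add hx (D.pE_σ hx))
  exact D.ψ'_trivial ⟨_, h.le⟩ ((mem_maximalIdeal_iff_valuation_lt_one _).2 h)

theorem ψ_eq_of_sub_mem {x y : E} (h : x - y ∈ D.pE 1) : D.ψ x = D.ψ y := by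
  rw [← sub_add_cancel x y, ψ_add, D.ψ_eq_one h, one_mul]

/-- The factor 1/2 in ψ makes it restrict to ψ' on F. -/
theorem exists_ψ_ne_one : ∃ y : E, valuation E y ≤ 1 ∧ D.ψ y ≠ 1 := by
  obtain ⟨y, hy⟩ := D.ψ'_nontrivial
  refine ⟨algebraMap F E y, valuation_algebraMap_le_one_iff.2 y.2, ?_⟩
  have h : Algebra.trace F E (algebraMap F E y) / 2 = y := by
    apply (algebraMap F E).injective
    rw [map_div₀, D.algebraMap_trace, AlgEquiv.commutes, map_ofNat, ← two_mul,
      mul_div_cancel_left₀ _ D.two_ne_zero_E]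
  rw [ψ, h]
  exact hy

end Ideals

/-- `ε⁻¹` is a norm modulo the maximal ideal. -/
theorem exists_norm_form_sub_lt_one (D : UnramifiedData F E) :
    ∃ a b : F, valuation F a ≤ 1 ∧ valuation F b ≤ 1 ∧
      valuation F (D.ε * (a ^ 2 - D.ε * b ^ 2) - 1) < 1 := by
  let e : 𝒪[F] := ⟨D.ε, D.ε_unit.le⟩
  let ρ := IsLocalRing.residue 𝒪[F]
  have he : ρ e ≠ 0 := by
    rw [Ne, IsLocalRing.residue_eq_zero_iff, mem_maximalIdeal_iff_valuation_lt_one]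
    exact D.ε_unit.not_lt
  have := Fintype.ofFinite 𝓀[F]
  -- Over the residue field the equation is (e a² - 1) + (-e² b²) = 0; two quadratics in separate
  -- variables over a finite field of odd order always have such a solution.
  obtain ⟨a, b, hab⟩ := FiniteField.exists_root_sum_quadratic (R := 𝓀[F])
    (f := Polynomial.C (ρ e) * Polynomial.X ^ 2 + Polynomial.C 0 * Polynomial.X +
      Polynomial.C (-1))
    (g := Polynomial.C (-(ρ e) ^ 2) * Polynomial.X ^ 2 + Polynomial.C 0 * Polynomial.X +
      Polynomial.C 0)
    (Polynomial.degree_quadratic he)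
    (Polynomial.degree_quadratic (neg_ne_zero.2 (pow_ne_zero 2 he)))
    (FiniteField.odd_card_of_char_ne_two D.residueChar_ne_two)
  obtain ⟨a, rfl⟩ := IsLocalRing.residue_surjective a
  obtain ⟨b, rfl⟩ := IsLocalRing.residue_surjective b
  refine ⟨a, b, a.2, b.2, ?_⟩
  refine (mem_maximalIdeal_iff_valuation_lt_one (e * (a ^ 2 - e * b ^ 2) - 1)).1 ?_
  rw [← IsLocalRing.residue_eq_zero_iff]
  simp only [map_zero, zero_mul, add_zero, Polynomial.eval_add, Polynomial.eval_mul,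
    Polynomial.eval_C, Polynomial.eval_pow, Polynomial.eval_X] at hab
  simp only [map_sub, map_mul, map_pow, map_one]
  linear_combination hab

/-- `ε⁻¹` is a norm from `E`. -/
theorem exists_norm_eq_inv_ε (D : UnramifiedData F E) :
    ∃ c : Eˣ, valuation E (c : E) = 1 ∧ (c : E) * D.σ c = algebraMap F E D.ε⁻¹ := by
  obtain ⟨a, b, ha, hb, h⟩ := D.exists_norm_form_sub_lt_one
  set n := D.ε * (a ^ 2 - D.ε * b ^ 2) with hn
  have hn1 : valuation F n = 1 := by
    have := Valuation.map_add_eq_of_lt_right (v := valuation F) (x := n - 1) (y := 1)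
      (by rwa [map_one])
    rwa [sub_add_cancel, map_one] at this
  -- As n ≡ 1, it is a square s², and dividing a + b √ε by s corrects its norm to exactly ε⁻¹.
  obtain ⟨s, hs⟩ := isSquare_of_valuation_sub_sq_lt_one D.valuation_two_F (c := 1) hn1.le
    (map_one _) (by rwa [one_pow, Valuation.map_sub_swap])
  have hs0 : s ≠ 0 := by
    rintro rfl
    rw [hs, mul_zero, map_zero] at hn1
    exact zero_ne_one hn1
  have hε : D.ε ≠ 0 := by
    intro h0
    have := D.ε_unit
    rw [h0, map_zero] at this
    exact zero_ne_one this
  let c : E := (algebraMap F E a + algebraMap F E b * D.sqrtε) / algebraMap F E s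
  have hc : c * D.σ c = algebraMap F E D.ε⁻¹ := by
    simp only [c]
    rw [map_div₀, AlgEquiv.commutes, div_mul_div_comm, D.mul_σ_eq, ← map_mul, ← hs, ← map_div₀, hn]
    congr 1
    have h5 : a ^ 2 - D.ε * b ^ 2 ≠ 0 := by
      intro h6
      rw [hn, h6, mul_zero, map_zero] at hn1
      exact zero_ne_one hn1
    field_simp
  have hv : valuation E c = 1 := by
    have h7 := congrArg (valuation E) hc
    rw [map_mul, D.valuation_σ, ← pow_two, valuation_algebraMap_eq_one_iff.2 (by
      rw [map_inv₀, D.ε_unit, inv_one])] at h7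
    exact (pow_eq_one_iff_of_nonneg zero_le two_ne_zero).1 h7
  have hc0 : c ≠ 0 := by
    rintro h0
    rw [h0, map_zero] at hv
    exact zero_ne_one hv
  exact ⟨Units.mk0 c hc0, hv, hc⟩

end UnramifiedData

/-! ### Induction from conjugate subgroups -/

section Induction

variable {K : Type*} [Group K] [TopologicalSpace K] [ContinuousMul K]

/-- Left translation by `g` carries `Ind_H Ψ` to `Ind_{gHg⁻¹} Ψ^g`. -/
def indSpaceTranslate {H₁ H₂ : Subgroup K} (Ψ₁ : H₁ →* ℂˣ) (Ψ₂ : H₂ →* ℂˣ) (g : K)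
    (h : ∀ k : H₂, ∃ hk : g⁻¹ * k * g ∈ H₁, Ψ₂ k = Ψ₁ ⟨_, hk⟩) :
    indSpace H₁ Ψ₁ →ₗ[ℂ] indSpace H₂ Ψ₂ :=
  (LinearMap.funLeft ℂ ℂ (fun x : K => g⁻¹ * x)).restrict (by
    rintro f ⟨hf, hf'⟩
    refine ⟨hf.comp_continuous (continuous_const_mul g⁻¹), fun k x => ?_⟩
    obtain ⟨hk, e⟩ := h k
    have h2 := hf' ⟨_, hk⟩ (g⁻¹ * x)
    rw [e]
    refine Eq.trans (congrArg f ?_) h2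
    group)

theorem indSpaceTranslate_apply {H₁ H₂ : Subgroup K} (Ψ₁ : H₁ →* ℂˣ) (Ψ₂ : H₂ →* ℂˣ) (g : K)
    (h : ∀ k : H₂, ∃ hk : g⁻¹ * k * g ∈ H₁, Ψ₂ k = Ψ₁ ⟨_, hk⟩) (f : indSpace H₁ Ψ₁) (x : K) :
    (indSpaceTranslate Ψ₁ Ψ₂ g h f : K → ℂ) x = (f : K → ℂ) (g⁻¹ * x) := rfl

/-- Characters of conjugate subgroups that correspond to each other induce isomorphic
representations. -/
theorem nonempty_indRep_equiv {H₁ H₂ : Subgroup K} (Ψ₁ : H₁ →* ℂˣ) (Ψ₂ : H₂ →* ℂˣ) (g : K)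
    (hH : ∀ k, k ∈ H₂ ↔ g⁻¹ * k * g ∈ H₁)
    (hΨ : ∀ k (h₂ : k ∈ H₂) (h₁ : g⁻¹ * k * g ∈ H₁), Ψ₂ ⟨k, h₂⟩ = Ψ₁ ⟨_, h₁⟩) :
    Nonempty ((indRep H₁ Ψ₁).Equiv (indRep H₂ Ψ₂)) := by
  have h : ∀ k : H₂, ∃ hk : g⁻¹ * k * g ∈ H₁, Ψ₂ k = Ψ₁ ⟨_, hk⟩ :=
    fun k => ⟨(hH k).1 k.2, hΨ k k.2 _⟩
  have h' : ∀ k : H₁, ∃ hk : g⁻¹⁻¹ * k * g⁻¹ ∈ H₂, Ψ₁ k = Ψ₂ ⟨_, hk⟩ := by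
    intro k
    have e : g⁻¹ * (g⁻¹⁻¹ * k * g⁻¹) * g = (k : K) := by group
    have hk : g⁻¹⁻¹ * k * g⁻¹ ∈ H₂ := (hH _).2 (by rw [e]; exact k.2)
    refine ⟨hk, ?_⟩
    rw [hΨ _ hk (by rw [e]; exact k.2)]
    congr 1
    exact Subtype.ext e.symm
  refine ⟨Representation.Equiv.mk (LinearEquiv.ofLinearMap (indSpaceTranslate Ψ₁ Ψ₂ g h)
    (indSpaceTranslate Ψ₂ Ψ₁ g⁻¹ h') ?_ ?_) ?_⟩
  · ext f x
    simp [indSpaceTranslate_apply]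
  · ext f x
    simp [indSpaceTranslate_apply]
  -- Left and right translations commute, so the map intertwines the actions.
  · intro k
    ext f x
    change (f : K → ℂ) (g⁻¹ * x * k) = (f : K → ℂ) (g⁻¹ * (x * k))
    rw [mul_assoc]

end Induction

namespace UnramifiedData

variable {F E : Type*}
  [Field F] [ValuativeRel F] [TopologicalSpace F] [IsNonarchimedeanLocalField F]
  [Field E] [ValuativeRel E] [TopologicalSpace E] [IsNonarchimedeanLocalField E]
  [Algebra F E] [ValuativeExtension F E]

/-! ### Matrix entries of elements of G, 𝒦 and Z -/

section Entries

variable (D : UnramifiedData F E)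

theorem mem_G_iff {g : GL (Fin 2) E} : g ∈ D.G ↔
    D.σ (g 0 0) * g 1 0 + D.σ (g 1 0) * g 0 0 = 0 ∧
    D.σ (g 0 0) * g 1 1 + D.σ (g 1 0) * g 0 1 = 1 ∧
    D.σ (g 0 1) * g 1 0 + D.σ (g 1 1) * g 0 0 = 1 ∧
    D.σ (g 0 1) * g 1 1 + D.σ (g 1 1) * g 0 1 = 0 := by
  change ((g : Matrix (Fin 2) (Fin 2) E).map D.σ)ᵀ * w * (g : Matrix (Fin 2) (Fin 2) E) = w ↔ _
  rw [← Matrix.ext_iff]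
  simp only [Fin.forall_fin_two, Matrix.mul_apply, Fin.sum_univ_two, w, Matrix.transpose_apply,
    Matrix.map_apply]
  simp only [of_apply, cons_val', cons_val_zero, cons_val_fin_one, mul_zero, cons_val_one, mul_one,
    zero_add, add_zero]
  constructor
  · rintro ⟨⟨h1, h2⟩, h3, h4⟩
    refine ⟨?_, ?_, ?_, ?_⟩ <;> rw [add_comm] <;> assumption
  · rintro ⟨h1, h2, h3, h4⟩
    refine ⟨⟨?_, ?_⟩, ?_, ?_⟩ <;> rw [add_comm] <;> assumption

theorem K_mul_apply (k l : D.K) (i j : Fin 2) : ((k * l : D.K) : GL (Fin 2) E) i j =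
    (k : GL (Fin 2) E) i 0 * (l : GL (Fin 2) E) 0 j +
      (k : GL (Fin 2) E) i 1 * (l : GL (Fin 2) E) 1 j := by
  simp [Matrix.mul_apply, Fin.sum_univ_two]

/-- Three relations suffice: the fourth unitarity relation is the conjugate of `h2`, and together
they say that w σ(M)ᵀ w is an integral inverse of M. -/
theorem exists_K {a b c e : E} (ha : valuation E a ≤ 1) (hb : valuation E b ≤ 1)
    (hc : valuation E c ≤ 1) (he : valuation E e ≤ 1)
    (h1 : D.σ a * c + D.σ c * a = 0) (h2 : D.σ a * e + D.σ c * b = 1)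
    (h3 : D.σ b * e + D.σ e * b = 0) :
    ∃ k : D.K, (k : GL (Fin 2) E) 0 0 = a ∧ (k : GL (Fin 2) E) 0 1 = b ∧
      (k : GL (Fin 2) E) 1 0 = c ∧ (k : GL (Fin 2) E) 1 1 = e := by
  have h2' : D.σ b * c + D.σ e * a = 1 := by
    have := congrArg D.σ h2
    simp only [map_add, map_mul, D.σ_σ, map_one] at this
    linear_combination this
  -- Lifts integral elements to 𝒪_E; the default value 0 is never met, since all entries are
  -- integral.
  let O : E → 𝒪[E] := fun y => if hy : valuation E y ≤ 1 then ⟨y, hy⟩ else 0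
  have hO : ∀ y, valuation E y ≤ 1 → (O y : E) = y := fun y hy => by simp [O, hy]
  have hσ : ∀ y, valuation E y ≤ 1 → valuation E (D.σ y) ≤ 1 := fun y hy => by
    rwa [D.valuation_σ]
  let M : Matrix (Fin 2) (Fin 2) 𝒪[E] := !![O a, O b; O c, O e]
  let N : Matrix (Fin 2) (Fin 2) 𝒪[E] := !![O (D.σ e), O (D.σ b); O (D.σ c), O (D.σ a)]
  have hNM : N * M = 1 := by
    ext i j
    fin_cases i <;> fin_cases j <;>
      simp [M, N, Matrix.mul_apply, Fin.sum_univ_two, hO, ha, hb, hc, he, hσ]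
    · linear_combination h2'
    · linear_combination h3
    · linear_combination h1
    · linear_combination h2
  let u : GL (Fin 2) 𝒪[E] := ⟨M, N, mul_eq_one_comm.1 hNM, hNM⟩
  let g := GeneralLinearGroup.map (n := Fin 2) (𝒪[E]).subtype u
  have e00 : g 0 0 = a := hO a ha
  have e01 : g 0 1 = b := hO b hb
  have e10 : g 1 0 = c := hO c hc
  have e11 : g 1 1 = e := hO e he
  refine ⟨⟨g, D.mem_G_iff.2 ?_, u, rfl⟩, e00, e01, e10, e11⟩
  rw [e00, e01, e10, e11]
  exact ⟨h1, h2, h2', h3⟩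

/-- `k⁻¹ = w (σ k)ᵀ w`. -/
theorem K_inv (k : D.K) : ((k⁻¹ : D.K) : GL (Fin 2) E) 0 0 = D.σ ((k : GL (Fin 2) E) 1 1) ∧
    ((k⁻¹ : D.K) : GL (Fin 2) E) 0 1 = D.σ ((k : GL (Fin 2) E) 0 1) ∧
    ((k⁻¹ : D.K) : GL (Fin 2) E) 1 0 = D.σ ((k : GL (Fin 2) E) 1 0) ∧
    ((k⁻¹ : D.K) : GL (Fin 2) E) 1 1 = D.σ ((k : GL (Fin 2) E) 0 0) := by
  obtain ⟨h1, h2, h3, h4⟩ := D.mem_G_iff.1 k.2.1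
  have hk := D.entry_mem k
  have hσ : ∀ i j, valuation E (D.σ ((k : GL (Fin 2) E) i j)) ≤ 1 := fun i j => by
    rw [D.valuation_σ]; exact hk i j
  have hN : (!![D.σ ((k : GL (Fin 2) E) 1 1), D.σ ((k : GL (Fin 2) E) 0 1);
      D.σ ((k : GL (Fin 2) E) 1 0), D.σ ((k : GL (Fin 2) E) 0 0)] : Matrix (Fin 2) (Fin 2) E) *
      (k : GL (Fin 2) E).1 = 1 := by
    ext i j
    fin_cases i <;> fin_cases j <;> simp [Matrix.mul_apply, Fin.sum_univ_two]
    · linear_combination h3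
    · linear_combination h4
    · linear_combination h1
    · linear_combination h2
  have e : ((k⁻¹ : D.K) : GL (Fin 2) E).1 = _ :=
    (left_inv_eq_right_inv hN (k : GL (Fin 2) E).mul_inv).symm
  have e' : ∀ i j, ((k⁻¹ : D.K) : GL (Fin 2) E) i j = _ := fun i j => congrFun (congrFun e i) j
  exact ⟨e' 0 0, e' 0 1, e' 1 0, e' 1 1⟩

/-- The eigenvalue of a scalar matrix. -/
def Zval : D.Z →* E where
  toFun z := (z : GL (Fin 2) E) 0 0
  map_one' := by simp
  map_mul' z z' := by
    obtain ⟨-, a, ha⟩ := z.2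
    simp [Matrix.mul_apply, Fin.sum_univ_two, ← ha, GeneralLinearGroup.scalar]

theorem exists_scalar (z : D.Z) :
    ∃ a : Eˣ, (z : GL (Fin 2) E) = GeneralLinearGroup.scalar (Fin 2) a ∧ D.Zval z = a := by
  obtain ⟨-, a, ha⟩ := z.2
  exact ⟨a, ha.symm, by simp [Zval, ← ha, GeneralLinearGroup.scalar]⟩

theorem σ_Zval_mul (z : D.Z) : D.σ (D.Zval z) * D.Zval z = 1 := by
  obtain ⟨a, ha, h⟩ := D.exists_scalar z
  rw [h]
  exact (D.scalar_mem_G_iff a).1 (ha ▸ z.2.1)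

theorem exists_Zval_eq {a : E} (h : D.σ a * a = 1) : ∃ z : D.Z, D.Zval z = a := by
  have ha : a ≠ 0 := right_ne_zero_of_mul_eq_one h
  exact ⟨⟨GeneralLinearGroup.scalar (Fin 2) (Units.mk0 a ha), (D.scalar_mem_G_iff _).2 h, _, rfl⟩,
    by simp [Zval, GeneralLinearGroup.scalar]⟩

theorem valuation_Zval (z : D.Z) : valuation E (D.Zval z) = 1 :=
  D.valuation_eq_one_of_norm_eq_one (D.σ_Zval_mul z)

theorem Zval_inv (z : D.Z) : D.Zval z⁻¹ = (D.Zval z)⁻¹ :=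
  eq_inv_of_mul_eq_one_left (by rw [← map_mul, inv_mul_cancel, map_one])

theorem σ_Zval (z : D.Z) : D.σ (D.Zval z) = (D.Zval z)⁻¹ :=
  eq_inv_of_mul_eq_one_left (D.σ_Zval_mul z)

/-- This is how depth zero of θ is used: θ depends on z only modulo 𝔭_E. -/
theorem apply_eq_of_Zval_sub_mem {θ : D.Z →* ℂˣ} (hθ : HasDepth D.Zfil θ 0) {n : ℤ} (hn : 1 ≤ n)
    {z z' : D.Z} (h : D.Zval z - D.Zval z' ∈ D.pE n) : θ z = θ z' := by
  have h1 : D.Zval (z * z'⁻¹) - 1 ∈ D.pE n := by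
    have e : D.Zval (z * z'⁻¹) - 1 = (D.Zval z - D.Zval z') * D.Zval z'⁻¹ := by
      rw [map_mul, sub_mul, ← map_mul _ z' z'⁻¹, mul_inv_cancel, map_one]
    rw [e]
    exact D.pE_mul_right h (D.valuation_Zval _).le
  obtain ⟨a, ha, h2⟩ := D.exists_scalar (z * z'⁻¹)
  have h3 := hθ.2 (z * z'⁻¹) ⟨a, ⟨?_, ?_⟩, ha⟩
  · rwa [map_mul, map_inv, mul_inv_eq_one] at h3
  · rw [← h2]; exact D.valuation_Zval _
  · rw [← h2]; exact D.pE_le (by push_cast; omega) h1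

end Entries

/-! ### The group Z 𝒰 𝒥_d and its characters -/

section Group

variable (D : UnramifiedData F E) (d : ℕ)

/-- The matrix `k` is congruent to an upper triangular one with both eigenvalues `a`. -/
def IsNear (k : D.K) (a : E) : Prop :=
  (k : GL (Fin 2) E) 0 0 - a ∈ D.pE ((d + 1) / 2 : ℕ) ∧
  (k : GL (Fin 2) E) 1 0 ∈ D.pE ((d + 2) / 2 : ℕ) ∧
  (k : GL (Fin 2) E) 1 1 - a ∈ D.pE ((d + 1) / 2 : ℕ)

variable {D d}

/-- The upper right entries are only integral, but in the diagonal of a product they are multiplied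
by lower left entries, which lie in 𝔭^⌈d/2⌉. -/
theorem IsNear.mul {k l : D.K} {z z' : D.Z} (hk : D.IsNear d k (D.Zval z))
    (hl : D.IsNear d l (D.Zval z')) : D.IsNear d (k * l) (D.Zval (z * z')) := by
  obtain ⟨k1, k2, k3⟩ := hk
  obtain ⟨l1, l2, l3⟩ := hl
  have hk := D.entry_mem k
  have hl := D.entry_mem l
  have hz := (D.valuation_Zval z).le
  have l2' : (l : GL (Fin 2) E) 1 0 ∈ D.pE ((d + 1) / 2 : ℕ) := D.pE_le (by omega) l2
  have k2' : (k : GL (Fin 2) E) 1 0 ∈ D.pE ((d + 1) / 2 : ℕ) := D.pE_le (by omega) k2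
  refine ⟨?_, ?_, ?_⟩
  · rw [K_mul_apply, map_mul, show (k : GL (Fin 2) E) 0 0 * (l : GL (Fin 2) E) 0 0 +
      (k : GL (Fin 2) E) 0 1 * (l : GL (Fin 2) E) 1 0 - D.Zval z * D.Zval z' =
      ((k : GL (Fin 2) E) 0 0 - D.Zval z) * (l : GL (Fin 2) E) 0 0 +
      D.Zval z * ((l : GL (Fin 2) E) 0 0 - D.Zval z') +
      (k : GL (Fin 2) E) 0 1 * (l : GL (Fin 2) E) 1 0 by ring]
    exact D.pE_add (D.pE_add (D.pE_mul_right k1 (hl _ _)) (D.pE_mul_left hz l1))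
      (D.pE_mul_left (hk _ _) l2')
  · rw [K_mul_apply]
    exact D.pE_add (D.pE_mul_right k2 (hl _ _)) (D.pE_mul_left (hk _ _) l2)
  · rw [K_mul_apply, map_mul, show (k : GL (Fin 2) E) 1 0 * (l : GL (Fin 2) E) 0 1 +
      (k : GL (Fin 2) E) 1 1 * (l : GL (Fin 2) E) 1 1 - D.Zval z * D.Zval z' =
      ((k : GL (Fin 2) E) 1 1 - D.Zval z) * (l : GL (Fin 2) E) 1 1 +
      D.Zval z * ((l : GL (Fin 2) E) 1 1 - D.Zval z') +
      (k : GL (Fin 2) E) 1 0 * (l : GL (Fin 2) E) 0 1 by ring]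
    exact D.pE_add (D.pE_add (D.pE_mul_right k3 (hl _ _)) (D.pE_mul_left hz l3))
      (D.pE_mul_right k2' (hl _ _))

theorem IsNear.inv {k : D.K} {z : D.Z} (hk : D.IsNear d k (D.Zval z)) :
    D.IsNear d k⁻¹ (D.Zval z⁻¹) := by
  obtain ⟨k1, k2, k3⟩ := hk
  obtain ⟨e1, -, e3, e4⟩ := D.K_inv k
  rw [IsNear, e1, e3, e4, Zval_inv, ← σ_Zval, ← map_sub, ← map_sub]
  exact ⟨D.pE_σ k3, D.pE_σ k2, D.pE_σ k1⟩

variable (D d)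

/-- The group `Z 𝒰 𝒥_d`. -/
def H : Subgroup D.K where
  carrier := {k | ∃ z : D.Z, D.IsNear d k (D.Zval z)}
  one_mem' := ⟨1, by simp [IsNear, zero_mem_pE]⟩
  mul_mem' := by
    rintro k l ⟨z, hz⟩ ⟨z', hz'⟩
    exact ⟨z * z', hz.mul hz'⟩
  inv_mem' := by
    rintro k ⟨z, hz⟩
    exact ⟨z⁻¹, hz.inv⟩

theorem J_le_H : D.J d ≤ D.H d := by
  rintro k ⟨h1, -, h3, h4⟩
  exact ⟨1, by rw [map_one]; exact ⟨h1, h3, h4⟩⟩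

variable {D d}

/-- The diagonal and lower left entries are controlled by `IsNear.mul`. For the upper right entry,
subtracting the unitarity relation σ(h₁₂) h₂₂ + σ(h₂₂) h₁₂ = 0 leaves only differences of entries of
k and h. -/
theorem inv_mul_mem_J {k h : D.K} {z : D.Z} (hk : D.IsNear d k (D.Zval z))
    (hh : D.IsNear d h (D.Zval z))
    (hu : (k : GL (Fin 2) E) 0 1 - (h : GL (Fin 2) E) 0 1 ∈ D.pE ((d + 1) / 2 : ℕ)) :
    h⁻¹ * k ∈ D.J d := by
  obtain ⟨n1, n2, n3⟩ := hh.inv.mul hk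
  rw [inv_mul_cancel, map_one] at n1 n3
  refine ⟨n1, ?_, n2, n3⟩
  obtain ⟨e1, e2, -, -⟩ := D.K_inv h
  obtain ⟨-, -, -, r4⟩ := D.mem_G_iff.1 h.2.1
  have hv := D.entry_mem h
  rw [K_mul_apply, e1, e2, show D.σ ((h : GL (Fin 2) E) 1 1) * (k : GL (Fin 2) E) 0 1 +
    D.σ ((h : GL (Fin 2) E) 0 1) * (k : GL (Fin 2) E) 1 1 =
    D.σ ((h : GL (Fin 2) E) 1 1) * ((k : GL (Fin 2) E) 0 1 - (h : GL (Fin 2) E) 0 1) +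
    D.σ ((h : GL (Fin 2) E) 0 1) * (((k : GL (Fin 2) E) 1 1 - D.Zval z) -
      ((h : GL (Fin 2) E) 1 1 - D.Zval z)) by linear_combination r4]
  refine D.pE_add (D.pE_mul_left ?_ hu) (D.pE_mul_left ?_ (D.pE_sub hk.2.2 hh.2.2)) <;>
    rw [D.valuation_σ] <;> exact hv _ _

/-- `𝒥_d` and a subgroup that contains approximations to all elements of `Z 𝒰` generate
`Z 𝒰 𝒥_d`. -/
theorem sup_J_eq_H {A : Subgroup D.K} (hA : A ≤ D.H d)
    (h : ∀ (z : D.Z) (u : E), valuation E u ≤ 1 → D.σ u = -u → ∃ a ∈ A,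
      D.IsNear d a (D.Zval z) ∧
      (a : GL (Fin 2) E) 0 1 - D.Zval z * u ∈ D.pE ((d + 1) / 2 : ℕ)) :
    A ⊔ D.J d = D.H d := by
  refine le_antisymm (sup_le hA (D.J_le_H d)) ?_
  rintro k ⟨z, hz⟩
  -- For an exact element of Z 𝒰 this y = z⁻¹ k₁₂ would satisfy σ(y) = -y. Unitarity of k gives y +
  -- σ(y) ∈ 𝔭^⌈d/2⌉ in general, so u = (y - σ(y)) / 2 is a sufficient approximation.
  set y := D.σ (D.Zval z) * (k : GL (Fin 2) E) 0 1 with hy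
  have hv := D.entry_mem k
  have hyv : valuation E y ≤ 1 := by
    rw [hy, map_mul, D.valuation_σ, D.valuation_Zval, one_mul]; exact hv _ _
  have hu1 : valuation E ((y - D.σ y) / 2) ≤ 1 := by
    rw [← D.mem_pE_zero] at hyv ⊢
    exact D.mem_pE_div_two (D.pE_sub hyv (D.pE_σ hyv))
  obtain ⟨a, ha, h1, h2⟩ := h z ((y - D.σ y) / 2) hu1 (by
    rw [map_div₀, map_sub, D.σ_σ, map_ofNat]; ring)
  obtain ⟨-, -, -, r4⟩ := D.mem_G_iff.1 k.2.1
  have hs : (y + D.σ y) ∈ D.pE ((d + 1) / 2 : ℕ) := by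
    have e : y + D.σ y = -(D.σ ((k : GL (Fin 2) E) 0 1) * ((k : GL (Fin 2) E) 1 1 - D.Zval z)) -
        D.σ ((k : GL (Fin 2) E) 1 1 - D.Zval z) * (k : GL (Fin 2) E) 0 1 := by
      rw [hy, map_mul, D.σ_σ, map_sub]
      linear_combination r4
    rw [e]
    refine D.pE_sub (D.pE_neg (D.pE_mul_left ?_ hz.2.2)) (D.pE_mul_right (D.pE_σ hz.2.2) (hv _ _))
    rw [D.valuation_σ]; exact hv _ _
  have hj : a⁻¹ * k ∈ D.J d := by
    refine inv_mul_mem_J hz h1 ?_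
    rw [show (k : GL (Fin 2) E) 0 1 - (a : GL (Fin 2) E) 0 1 = D.Zval z * ((y + D.σ y) / 2) -
      ((a : GL (Fin 2) E) 0 1 - D.Zval z * ((y - D.σ y) / 2)) by
        have h2 := D.two_ne_zero_E
        have e : D.Zval z * y = (k : GL (Fin 2) E) 0 1 := by
          rw [hy, ← mul_assoc, mul_comm (D.Zval z), D.σ_Zval_mul, one_mul]
        rw [← e]
        field_simp
        ring]
    exact D.pE_sub (D.pE_mul_left (D.valuation_Zval z).le (D.mem_pE_div_two hs)) h2
  rw [← mul_inv_cancel_left a k]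
  exact mul_mem ((le_sup_left : A ≤ _) ha) ((le_sup_right : D.J d ≤ _) hj)

variable (D)

/-- The values of `ψ`, as units. -/
def ψu (x : E) : ℂˣ := ⟨D.ψ x, D.ψ (-x), by rw [← D.ψ_add, add_neg_cancel, D.ψ_zero],
  by rw [← D.ψ_add, neg_add_cancel, D.ψ_zero]⟩

theorem ψu_val (x : E) : (D.ψu x : ℂ) = D.ψ x := rfl

variable (d)

/-- The function `z u j ↦ θ(z) ψ(Tr(X_δ (j - 1)))` on `Z 𝒰 𝒥_d`. -/
def charFun (θ : D.Z →* ℂˣ) (δ : F) (k : D.H d) : ℂˣ :=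
  θ k.2.choose * D.ψu (algebraMap F E δ * D.sqrtε * D.Zval k.2.choose⁻¹ *
    ((k : D.K) : GL (Fin 2) E) 1 0)

variable {d}

/-- The choice of z is harmless: it is determined modulo 𝔭^⌈d/2⌉, with ⌈d/2⌉ ≥ 1 so that θ is
unaffected, and the argument of ψ changes by an element of 𝔭^(-d + ⌈d/2⌉ + ⌈(d+1)/2⌉) = 𝔭. -/
theorem charFun_eq {θ : D.Z →* ℂˣ} (hθ : HasDepth D.Zfil θ 0) (hd : 0 < d) {δ : F}
    (hδ : algebraMap F E δ ∈ D.pE (-(d : ℤ))) {k : D.H d} {z : D.Z}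
    (h : D.IsNear d k (D.Zval z)) :
    D.charFun d θ δ k = θ z * D.ψu (algebraMap F E δ * D.sqrtε * D.Zval z⁻¹ *
      ((k : D.K) : GL (Fin 2) E) 1 0) := by
  have h' := k.2.choose_spec
  have hs : D.Zval k.2.choose - D.Zval z ∈ D.pE ((d + 1) / 2 : ℕ) := by
    have := D.pE_sub h.1 h'.1
    rwa [sub_sub_sub_cancel_left] at this
  have hs' : D.Zval k.2.choose⁻¹ - D.Zval z⁻¹ ∈ D.pE ((d + 1) / 2 : ℕ) := by
    rw [Zval_inv, Zval_inv, ← σ_Zval, ← σ_Zval, ← map_sub]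
    exact D.pE_σ hs
  rw [charFun, D.apply_eq_of_Zval_sub_mem hθ (by omega) hs]
  congr 1
  refine Units.ext (D.ψ_eq_of_sub_mem ?_)
  rw [← sub_mul, ← mul_sub]
  have := D.pE_mul (D.pE_mul (D.pE_mul_right hδ D.valuation_sqrtε.le) hs') h.2.1
  exact D.pE_le (by omega) this

variable (d)

/-- The character of `Z 𝒰 𝒥_d` that extends `θ` and is given by `X_δ` on `𝒥_d`. -/
def charHom {θ : D.Z →* ℂˣ} (hθ : HasDepth D.Zfil θ 0) (hd : 0 < d) {δ : F}
    (hδ : algebraMap F E δ ∈ D.pE (-(d : ℤ))) : D.H d →* ℂˣ :=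
  MonoidHom.mk' (D.charFun d θ δ) (by
    intro k l
    obtain ⟨z, hz⟩ := k.2
    obtain ⟨z', hz'⟩ := l.2
    have hkl : D.IsNear d (k * l : D.H d) (D.Zval (z * z')) := hz.mul hz'
    rw [D.charFun_eq hθ hd hδ hz, D.charFun_eq hθ hd hδ hz', D.charFun_eq hθ hd hδ hkl, map_mul]
    rw [mul_mul_mul_comm]
    congr 1
    apply Units.ext
    rw [Units.val_mul, ψu_val, ψu_val, ψu_val, ← D.ψ_add]
    apply D.ψ_eq_of_sub_mem
    have e0 : D.Zval (z * z')⁻¹ = D.Zval z⁻¹ * D.Zval z'⁻¹ := by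
      rw [_root_.mul_inv_rev, map_mul, mul_comm]
    rw [Subgroup.coe_mul, K_mul_apply, e0]
    have e1 : D.Zval z⁻¹ * D.Zval z = 1 := by rw [← map_mul, inv_mul_cancel, map_one]
    have e2 : D.Zval z'⁻¹ * D.Zval z' = 1 := by rw [← map_mul, inv_mul_cancel, map_one]
    set a := algebraMap F E δ * D.sqrtε
    have ha : a ∈ D.pE (-(d : ℤ)) := D.pE_mul_right hδ D.valuation_sqrtε.le
    set k' := ((k : D.K) : GL (Fin 2) E)
    set l' := ((l : D.K) : GL (Fin 2) E)
    -- In (k l)₂₁ = k₂₁ l₁₁ + k₂₂ l₂₁, replacing l₁₁ by z' and k₂₂ by z costs terms in 𝔭^(d+1),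
    -- which a carries into 𝔭.
    rw [show a * (D.Zval z⁻¹ * D.Zval z'⁻¹) * (k' 1 0 * l' 0 0 + k' 1 1 * l' 1 0) -
      (a * D.Zval z⁻¹ * k' 1 0 + a * D.Zval z'⁻¹ * l' 1 0) =
      a * (D.Zval z⁻¹ * D.Zval z'⁻¹ * (k' 1 0 * (l' 0 0 - D.Zval z') +
        (k' 1 1 - D.Zval z) * l' 1 0)) by
        linear_combination a * D.Zval z⁻¹ * k' 1 0 * e2 + a * D.Zval z'⁻¹ * l' 1 0 * e1]
    have h1 : k' 1 0 * (l' 0 0 - D.Zval z') ∈ D.pE (d + 1) :=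
      D.pE_le (by omega) (D.pE_mul hz.2.1 hz'.1)
    have h2 : (k' 1 1 - D.Zval z) * l' 1 0 ∈ D.pE (d + 1) :=
      D.pE_le (by omega) (D.pE_mul hz.2.2 hz'.2.1)
    refine D.pE_le (by omega) (D.pE_mul ha (D.pE_mul_left ?_ (D.pE_add h1 h2)))
    rw [map_mul, valuation_Zval, valuation_Zval, one_mul])

variable {D d}

/-- A criterion for `Ψ_{X,ζ}` to exist and to be the character `charHom` of `Z 𝒰 𝒥_d`. -/
theorem exists_admissible {θ : D.Z →* ℂˣ} (hθ : HasDepth D.Zfil θ 0) (hd : 0 < d) {δ : F}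
    (hδ : algebraMap F E δ ∈ D.pE (-(d : ℤ))) {X : Matrix (Fin 2) (Fin 2) E}
    {ζ : D.cent X →* ℂˣ} (hX : D.cent X ⊔ D.J d = D.H d)
    (hζ : ∀ k : D.cent X, ∃ z : D.Z, D.IsNear d k (D.Zval z) ∧
      ((k : D.K) : GL (Fin 2) E) 1 0 ∈ D.pE (d + 1) ∧ ζ k = θ z)
    (hψ : ∀ j ∈ D.J d, D.ψ (Matrix.trace (X * (((j : D.K) : GL (Fin 2) E).1 - 1))) =
      D.ψ (algebraMap F E δ * D.sqrtε * (j : GL (Fin 2) E) 1 0)) :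
    ∃ h : D.Admissible d X ζ, ∀ (k : D.K) (hk : k ∈ D.cent X ⊔ D.J d) (hk' : k ∈ D.H d),
      h.char ⟨k, hk⟩ = D.charHom d hθ hd hδ ⟨k, hk'⟩ := by
  let Ψ : ↥(D.cent X ⊔ D.J d) →* ℂˣ := (D.charHom d hθ hd hδ).comp (Subgroup.inclusion hX.le)
  have hΨ : D.IsExtension d X ζ Ψ := by
    refine ⟨fun k => ?_, fun j => ?_⟩
    · obtain ⟨z, hz, h1, h2⟩ := hζ k
      refine (D.charFun_eq hθ hd hδ (k := ⟨k, z, hz⟩) hz).trans ?_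
      rw [h2, mul_eq_left]
      -- On T(X) the lower left entry lies in 𝔭^(d+1), so the factor ψ disappears and θ(z) remains.
      refine Units.ext (D.ψ_eq_one ?_)
      exact D.pE_le (by omega) (D.pE_mul (D.pE_mul_right (D.pE_mul_right hδ D.valuation_sqrtε.le)
        (D.valuation_Zval z⁻¹).le) h1)
    · have hj : D.IsNear d j (D.Zval 1) := by
        rw [map_one]; exact ⟨j.2.1, j.2.2.2.1, j.2.2.2.2⟩
      refine (congrArg Units.val (D.charFun_eq hθ hd hδ (k := ⟨j, 1, hj⟩) hj)).trans ?_
      rw [hψ _ j.2, map_one, inv_one, map_one, one_mul, mul_one]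
      rfl
  refine ⟨⟨Ψ, hΨ⟩, fun k hk hk' => ?_⟩
  have h : D.Admissible d X ζ := ⟨Ψ, hΨ⟩
  rw [IsExtension.unique h.choose_spec hΨ |> fun e => show h.char = Ψ from e]
  rfl

end Group

end UnramifiedData

namespace UnramifiedData

variable {F E : Type*}
  [Field F] [ValuativeRel F] [TopologicalSpace F] [IsNonarchimedeanLocalField F]
  [Field E] [ValuativeRel E] [TopologicalSpace E] [IsNonarchimedeanLocalField E]
  [Algebra F E] [ValuativeExtension F E]

theorem trace_mul_sub_one (a b c e : E) (M : Matrix (Fin 2) (Fin 2) E) :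
    Matrix.trace (!![a, b; c, e] * (M - 1)) =
      a * (M 0 0 - 1) + b * M 1 0 + (c * M 0 1 + e * (M 1 1 - 1)) := by
  rw [Matrix.trace_fin_two, Matrix.mul_apply, Matrix.mul_apply, Fin.sum_univ_two,
    Fin.sum_univ_two]
  simp [Matrix.sub_apply]

/-! ### The nilpotent pair (X_δ, θ) -/

section Nilpotent

variable {D : UnramifiedData F E} {d : ℕ}

theorem cent_nilp_isNear {δ : F} (hδ : δ ≠ 0) (k : D.cent (D.nilp δ)) :
    D.IsNear d k (D.Zval (D.nilpProj hδ k)) := by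
  obtain ⟨h1, h2, h3⟩ := D.cent_nilp hδ k
  have e : D.Zval (D.nilpProj hδ k) = ((k : D.K) : GL (Fin 2) E) 0 0 := by
    simp [Zval, nilpProj, GeneralLinearGroup.scalar]
  obtain ⟨-, h4, -, -⟩ := D.mem_G_iff.1 k.1.2.1
  have h5 : ((k : D.K) : GL (Fin 2) E) 1 1 = ((k : D.K) : GL (Fin 2) E) 0 0 := by
    rw [h1, map_zero, zero_mul, add_zero, ← h3] at h4
    exact mul_left_cancel₀ (left_ne_zero_of_mul_eq_one h3) h4
  rw [IsNear, e, h5, h1, sub_self]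
  exact ⟨D.zero_mem_pE, D.zero_mem_pE, D.zero_mem_pE⟩

theorem cent_nilp_sup_J {δ : F} (hδ : δ ≠ 0) : D.cent (D.nilp δ) ⊔ D.J d = D.H d := by
  refine sup_J_eq_H (fun k hk => ⟨_, cent_nilp_isNear hδ ⟨k, hk⟩⟩) fun z u hu hσ => ?_
  have hz := D.σ_Zval_mul z
  have hzv := D.valuation_Zval z
  obtain ⟨k, e1, e2, e3, e4⟩ := D.exists_K (a := D.Zval z) (b := D.Zval z * u) (c := 0)
    (e := D.Zval z) hzv.le (by rw [map_mul, hzv, one_mul]; exact hu) (by simp) hzv.le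
    (by simp) (by simpa using hz) (by rw [map_mul, hσ]; ring)
  refine ⟨k, ?_, ?_, ?_⟩
  · change (k : GL (Fin 2) E).1 * D.nilp δ = D.nilp δ * (k : GL (Fin 2) E).1
    ext i j
    fin_cases i <;> fin_cases j <;>
      simp [nilp, Matrix.mul_apply, Fin.sum_univ_two, e1, e3, e4, mul_comm]
  · rw [IsNear, e1, e3, e4, sub_self]
    exact ⟨D.zero_mem_pE, D.zero_mem_pE, D.zero_mem_pE⟩
  · rw [e2, sub_self]
    exact D.zero_mem_pE

theorem exists_nilp_admissible {θ : D.Z →* ℂˣ} (hθ : HasDepth D.Zfil θ 0) (hd : 0 < d) {δ : F}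
    (hδ0 : δ ≠ 0) (hδ : algebraMap F E δ ∈ D.pE (-(d : ℤ))) :
    ∃ h : D.Admissible d (D.nilp δ) (D.nilpChar hδ0 θ),
      ∀ (k : D.K) (hk : k ∈ D.cent (D.nilp δ) ⊔ D.J d) (hk' : k ∈ D.H d),
        h.char ⟨k, hk⟩ = D.charHom d hθ hd hδ ⟨k, hk'⟩ := by
  refine exists_admissible hθ hd hδ (cent_nilp_sup_J hδ0) (fun k => ⟨D.nilpProj hδ0 k,
    cent_nilp_isNear hδ0 k, ?_, rfl⟩) fun j _ => ?_
  · rw [(D.cent_nilp hδ0 k).1]; exact D.zero_mem_pE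
  · congr 1
    rw [nilp, trace_mul_sub_one]
    ring

end Nilpotent

/-- A unit whose norm is close to one is close to an element of norm one. -/
theorem exists_Zval_sub_mem (D : UnramifiedData F E) {α : E} (hα : valuation E α = 1) {n : ℤ}
    (hN : α * D.σ α - 1 ∈ D.pE n) : ∃ z : D.Z, D.Zval z - α ∈ D.pE n := by
  -- A sign s for which 1 + s α is a unit: the sum of 1 + α and 1 - α is the unit 2, so they cannot
  -- both lie in 𝔭_E.
  have hs : ∃ s : E, s * s = 1 ∧ D.σ s = s ∧ valuation E (1 + s * α) = 1 := by
    have hle : valuation E (1 + α) ≤ 1 :=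
      ((valuation E).map_add _ _).trans (max_le (map_one _).le hα.le)
    rcases hle.lt_or_eq with h | h
    · refine ⟨-1, by ring, by simp, ?_⟩
      have := Valuation.map_sub_eq_of_lt_left (v := valuation E) (x := 2) (y := 1 + α)
        (by rwa [D.valuation_two])
      rw [D.valuation_two] at this
      rw [← this]
      congr 1
      ring
    · exact ⟨1, by ring, by simp, by rwa [one_mul]⟩
  obtain ⟨s, hs1, hs2, hs3⟩ := hs
  have hσ : D.σ (1 + s * α) = 1 + s * D.σ α := by rw [map_add, map_one, map_mul, hs2]
  have hs4 : valuation E (1 + s * D.σ α) = 1 := by rw [← hσ, D.valuation_σ, hs3]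
  have h0 : 1 + s * α ≠ 0 := by
    intro h; rw [h, map_zero] at hs3; exact zero_ne_one hs3
  have h0' : 1 + s * D.σ α ≠ 0 := by
    intro h; rw [h, map_zero] at hs4; exact zero_ne_one hs4
  -- A quotient of the form b / σ(b) has norm one, as in Hilbert 90. If α had norm one, s (1 + s α)
  -- / (1 + s σ(α)) would be α itself; in general the error is a multiple of α σ(α) - 1.
  obtain ⟨z, hz⟩ := D.exists_Zval_eq (a := s * ((1 + s * α) / (1 + s * D.σ α))) (by
    simp only [map_mul, map_div₀, map_add, map_one, hs2, D.σ_σ]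
    field_simp
    linear_combination hs1)
  refine ⟨z, ?_⟩
  have e : s * ((1 + s * α) / (1 + s * D.σ α)) - α =
      (α * D.σ α - 1) * (-s / (1 + s * D.σ α)) := by
    field_simp
    linear_combination α * hs1
  rw [hz, e]
  refine D.pE_mul_right hN ?_
  have hs5 : valuation E s = 1 := D.valuation_eq_one_of_norm_eq_one (by rw [hs2, hs1])
  rw [map_div₀, Valuation.map_neg, hs4, hs5, div_one]

/-! ### The pair (Y_χ, ζ_χ) and the comparison -/

section Torus

variable {D : UnramifiedData F E} {d : ℕ} {x : E}

theorem gd_conj (hx : x + D.σ x ≠ 0) (α β : E) :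
    (D.gd hx d).1 * !![α, 0; 0, β] * ((D.gd hx d)⁻¹ : GL (Fin 2) E).1 =
      !![(α + β) / 2, (α - β) / 2 * (D.γ x d)⁻¹; (α - β) / 2 * D.γ x d, (α + β) / 2] := by
  have h1 := D.γ_ne_zero hx d
  have h2 := D.two_ne_zero_E
  have h : (D.gd hx d).1 * !![α, 0; 0, β] =
      !![(α + β) / 2, (α - β) / 2 * (D.γ x d)⁻¹; (α - β) / 2 * D.γ x d, (α + β) / 2] *
        (D.gd hx d).1 := by
    ext i j
    fin_cases i <;> fin_cases j <;>
      simp [gd, GeneralLinearGroup.mkOfDetNeZero, Matrix.mul_apply, Fin.sum_univ_two] <;>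
      field_simp <;> ring
  rw [h, Units.mul_inv_cancel_right]

theorem Y_eq (hx : x + D.σ x ≠ 0) : D.Y hx d =
    !![(x - D.σ x) / 2, (x + D.σ x) / 2 * (D.γ x d)⁻¹;
      (x + D.σ x) / 2 * D.γ x d, (x - D.σ x) / 2] := by
  rw [Y, Γ, gd_conj, sub_neg_eq_add, ← sub_eq_add_neg]

/-- Matrices of this form are the g_d-conjugates of the diagonal ones, as is Y_χ, hence they commute
with it. -/
theorem mem_cent_Y (hx : x + D.σ x ≠ 0) {k : D.K} {p q : E}
    (h00 : (k : GL (Fin 2) E) 0 0 = p) (h01 : (k : GL (Fin 2) E) 0 1 = q * (D.γ x d)⁻¹)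
    (h10 : (k : GL (Fin 2) E) 1 0 = q * D.γ x d) (h11 : (k : GL (Fin 2) E) 1 1 = p) :
    k ∈ D.cent (D.Y hx d) := by
  change (k : GL (Fin 2) E).1 * D.Y hx d = D.Y hx d * (k : GL (Fin 2) E).1
  rw [Y_eq]
  ext i j
  fin_cases i <;> fin_cases j <;>
    simp [Matrix.mul_apply, Fin.sum_univ_two, h00, h01, h10, h11] <;> ring

theorem exists_tor_of_cent_Y (hx : x + D.σ x ≠ 0) (χ : D.T →* ℂˣ) (k : D.cent (D.Y hx d)) :
    ∃ α : Eˣ, D.zeta χ hx d k = χ (D.t α) ∧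
      ((k : D.K) : GL (Fin 2) E).1 = !![((α : E) + (D.σ α)⁻¹) / 2,
        ((α : E) - (D.σ α)⁻¹) / 2 * (D.γ x d)⁻¹;
        ((α : E) - (D.σ α)⁻¹) / 2 * D.γ x d, ((α : E) + (D.σ α)⁻¹) / 2] := by
  obtain ⟨α, hα⟩ := D.conj_mem_T hx d k
  refine ⟨α, ?_, ?_⟩
  · change χ _ = χ _
    congr 1
    exact Subtype.ext hα.symm
  · rw [← gd_conj hx, ← tor_val, hα]
    simp only [← Units.val_mul]
    congr 1
    group

theorem γ_mem_pE {r : ℕ} (hx : x ∈ D.pE (-(r : ℤ))) : D.γ x d ∈ D.pE (d - r) := by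
  have h : (x + D.σ x) * algebraMap F E D.ϖ ^ d ∈ D.pE (-(r : ℤ) + d) :=
    D.pE_mul (D.pE_add hx (D.pE_σ hx)) (by simpa using D.ϖ_zpow_mem_pE d)
  exact D.pE_le (by omega) (D.mem_pE_div_two (D.pE_mul_right h D.valuation_sqrtε.le))

theorem t_mem_Tfil {n : ℕ} (hn : 1 ≤ n) {α : Eˣ} (hα : (α : E) - 1 ∈ D.pE n) :
    D.t α ∈ D.Tfil n :=
  ⟨α, ⟨D.valuation_eq_one_of_sub_one_mem (by omega) hα, hα⟩, rfl⟩

theorem centralChar_eq (χ : D.T →* ℂˣ) (z : D.Z) {a : Eˣ} (ha : D.Zval z = a) :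
    D.centralChar χ z = χ (D.t a) := by
  obtain ⟨b, hb, e⟩ := D.exists_scalar z
  obtain rfl : a = b := Units.ext (ha.symm.trans e)
  change χ _ = χ _
  congr 1
  apply Subtype.ext
  change (z : GL (Fin 2) E) = D.tor a
  rw [hb]
  have h2 : (D.σ (a : E))⁻¹ = a := by rw [← e, D.σ_Zval, inv_inv]
  ext i j
  fin_cases i <;> fin_cases j <;>
    simp [tor, GeneralLinearGroup.mkOfDetNeZero, GeneralLinearGroup.scalar, h2]

/-- Integrality of the upper right entry q γ⁻¹ forces q ∈ 𝔭^(d-r). Since α σ(α) - 1 = 2 q σ(α), the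
unit α is within 𝔭^(d-r) of an element z of norm one, and this z serves for both k and χ. -/
theorem cent_Y_isNear (hx : x + D.σ x ≠ 0) {r : ℕ} (hxr : x ∈ D.pE (-(r : ℤ))) (hd : 2 * r < d)
    {χ : D.T →* ℂˣ} (hχ : ∀ t ∈ D.Tfil (r + 1), χ t = 1) (k : D.cent (D.Y hx d)) :
    ∃ z : D.Z, D.IsNear d k (D.Zval z) ∧ ((k : D.K) : GL (Fin 2) E) 1 0 ∈ D.pE (d + 1) ∧
      D.zeta χ hx d k = D.centralChar χ z := by
  obtain ⟨α, hζ, hk⟩ := exists_tor_of_cent_Y hx χ k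
  have h1 := D.γ_ne_zero hx d
  have h2 := D.two_ne_zero_E
  have hγ : D.γ x d ∈ D.pE (d - r) := γ_mem_pE hxr
  have hv := D.entry_mem k.1
  have hk' (i j) : ((k : D.K) : GL (Fin 2) E) i j = _ := congrFun (congrFun hk i) j
  set q := ((α : E) - (D.σ α)⁻¹) / 2 with hq
  set p := ((α : E) + (D.σ α)⁻¹) / 2 with hp
  have e00 : ((k : D.K) : GL (Fin 2) E) 0 0 = p := hk' 0 0
  have e01 : ((k : D.K) : GL (Fin 2) E) 0 1 = q * (D.γ x d)⁻¹ := hk' 0 1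
  have e10 : ((k : D.K) : GL (Fin 2) E) 1 0 = q * D.γ x d := hk' 1 0
  have e11 : ((k : D.K) : GL (Fin 2) E) 1 1 = p := hk' 1 1
  have hqm : q ∈ D.pE (d - r) := by
    have h3 := D.pE_mul_left (hv 0 1) hγ
    rwa [e01, inv_mul_cancel_right₀ h1] at h3
  have hα : (α : E) = p + q := by rw [hp, hq]; field_simp; ring
  have hσα : D.σ α ≠ 0 := by rw [Ne, map_eq_zero]; exact α.ne_zero
  have hαv' : valuation E (α : E) ≤ 1 := by
    rw [hα, ← D.mem_pE_zero]
    exact D.pE_add (D.mem_pE_zero.2 (e00 ▸ hv 0 0)) (D.pE_le (by omega) hqm)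
  have hN : (α : E) * D.σ α - 1 ∈ D.pE (d - r) := by
    have e : (α : E) * D.σ α - 1 = q * (2 * D.σ α) := by rw [hq]; field_simp
    rw [e]
    refine D.pE_mul_right hqm ?_
    rwa [map_mul, D.valuation_two, one_mul, D.valuation_σ]
  have hαv : valuation E (α : E) = 1 := by
    have h3 := D.valuation_eq_one_of_sub_one_mem (n := d - r) (by omega) hN
    rw [map_mul, D.valuation_σ, ← pow_two] at h3
    exact (pow_eq_one_iff_of_nonneg zero_le two_ne_zero).1 h3
  obtain ⟨z, hz⟩ := D.exists_Zval_sub_mem hαv hN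
  have hpz : p - D.Zval z ∈ D.pE (d - r) := by
    rw [show p - D.Zval z = -(D.Zval z - α) - q by rw [hα]; ring]
    exact D.pE_sub (D.pE_neg hz) hqm
  have h10 : ((k : D.K) : GL (Fin 2) E) 1 0 ∈ D.pE (d + 1) := by
    rw [e10]
    -- The exponent 2 (d - r) is at least d + 1, since d > 2r.
    exact D.pE_le (by omega) (D.pE_mul hqm hγ)
  refine ⟨z, ⟨?_, D.pE_le (by omega) h10, ?_⟩, h10, ?_⟩
  · rw [e00]; exact D.pE_le (by omega) hpz
  · rw [e11]; exact D.pE_le (by omega) hpz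
  · obtain ⟨a, -, ha⟩ := D.exists_scalar z
    rw [hζ, centralChar_eq χ z ha, ← mul_inv_eq_one, ← map_inv, ← map_inv, ← map_mul, ← map_mul]
    -- α z⁻¹ ∈ 1 + 𝔭^(d-r), and d - r ≥ r + 1, beyond the depth of χ.
    refine hχ _ (t_mem_Tfil (by omega) ?_)
    have e : ((α * a⁻¹ : Eˣ) : E) - 1 = -(D.Zval z - α) * D.Zval z⁻¹ := by
      rw [D.Zval_inv, Units.val_mul, ha, Units.val_inv_eq_inv_val]
      field_simp
      ring
    rw [e]
    exact D.pE_le (by omega) (D.pE_mul_right (D.pE_neg hz) (D.valuation_Zval _).le)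

theorem cent_Y_sup_J (hx : x + D.σ x ≠ 0) {r : ℕ} (hxr : x ∈ D.pE (-(r : ℤ))) (hd : 2 * r < d) :
    D.cent (D.Y hx d) ⊔ D.J d = D.H d := by
  refine sup_J_eq_H (fun k hk => ?_) fun z u hu hσ => ?_
  -- Only the nearness is wanted here, so the trivial character does.
  · obtain ⟨z, hz, -⟩ := cent_Y_isNear hx hxr hd (χ := 1) (fun _ _ => rfl) ⟨k, hk⟩
    exact ⟨z, hz⟩
  have h1 := D.γ_ne_zero hx d
  have h2 := D.two_ne_zero_E
  have hγ : D.γ x d ∈ D.pE (d - r) := γ_mem_pE hxr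
  have hz := D.σ_Zval_mul z
  have hzv := D.valuation_Zval z
  -- The approximation to z (1 u; 0 1) is the conjugate of t(α) for α = z (1 + y). As u and γ both
  -- change sign under σ, y is fixed by σ, so (σ α)⁻¹ = z (1 + y)⁻¹; hence q ≡ y up to second order,
  -- and the upper right entry z q γ⁻¹ is close to z u.
  set y := u * D.γ x d with hy
  have hym : y ∈ D.pE (d - r) := D.pE_mul_left hu hγ
  have hyσ : D.σ y = y := by rw [hy, map_mul, hσ, D.σ_γ]; ring
  have hsv : valuation E (1 + y) = 1 :=
    D.valuation_eq_one_of_sub_one_mem (n := d - r) (by omega) (by rwa [add_sub_cancel_left])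
  have hs0 : 1 + y ≠ 0 := by
    intro h; rw [h, map_zero] at hsv; exact zero_ne_one hsv
  have hsi : valuation E (1 + y)⁻¹ = 1 := by rw [map_inv₀, hsv, inv_one]
  set p := ((1 + y) + (1 + y)⁻¹) / 2 with hp
  set q := ((1 + y) - (1 + y)⁻¹) / 2 with hq
  have hpσ : D.σ p = p := by
    rw [hp, map_div₀, map_add, map_inv₀, map_add, hyσ, map_one, map_ofNat]
  have hqσ : D.σ q = q := by
    rw [hq, map_div₀, map_sub, map_inv₀, map_add, hyσ, map_one, map_ofNat]
  have hpq : p * p - q * q = 1 := by rw [hp, hq]; field_simp; ring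
  have hp1 : p - 1 ∈ D.pE (d - r) := by
    rw [show p - 1 = y * (y * (1 + y)⁻¹) / 2 by rw [hp]; field_simp; ring]
    refine D.mem_pE_div_two (D.pE_mul_right hym ?_)
    rw [map_mul, hsi, mul_one]
    exact D.mem_pE_zero.1 (D.pE_le (by omega) hym)
  have hq1 : q - y ∈ D.pE (2 * (d - r)) := by
    rw [show q - y = -(y * y * (1 + y)⁻¹) / 2 by rw [hq]; field_simp; ring]
    refine D.mem_pE_div_two (D.pE_neg (D.pE_mul_right ?_ hsi.le))
    exact D.pE_le (by omega) (D.pE_mul hym hym)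
  have hqu : q * (D.γ x d)⁻¹ - u ∈ D.pE (d - r) := by
    rw [show q * (D.γ x d)⁻¹ - u = -(u * (y * (1 + y)⁻¹)) / 2 by
      rw [show u = y * (D.γ x d)⁻¹ by rw [hy, mul_inv_cancel_right₀ h1], hq]; field_simp; ring]
    exact D.mem_pE_div_two (D.pE_neg (D.pE_mul_left hu (D.pE_mul_right hym hsi.le)))
  have hqγ : q * D.γ x d ∈ D.pE (2 * (d - r)) := by
    refine D.pE_le (by omega) (D.pE_mul (m := d - r) ?_ hγ)
    rw [← sub_add_cancel q y]
    exact D.pE_add (D.pE_le (by omega) hq1) hym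
  have hpv : valuation E p ≤ 1 := (D.valuation_eq_one_of_sub_one_mem (by omega) hp1).le
  have hquv : valuation E (q * (D.γ x d)⁻¹) ≤ 1 := by
    rw [← D.mem_pE_zero, ← sub_add_cancel (q * (D.γ x d)⁻¹) u]
    exact D.pE_add (D.pE_le (by omega) hqu) (D.mem_pE_zero.2 hu)
  have hqγv : valuation E (q * D.γ x d) ≤ 1 := D.mem_pE_zero.1 (D.pE_le (by omega) hqγ)
  have hmul {a : E} (ha : valuation E a ≤ 1) : valuation E (D.Zval z * a) ≤ 1 := by
    rwa [map_mul, hzv, one_mul]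
  obtain ⟨k, e1, e2, e3, e4⟩ := D.exists_K (hmul hpv) (hmul hquv) (hmul hqγv) (hmul hpv)
    (by simp only [map_mul, hpσ, hqσ, D.σ_γ]; ring)
    (by
      simp only [map_mul, hpσ, hqσ, D.σ_γ]
      have h3 : D.γ x d * (D.γ x d)⁻¹ = 1 := mul_inv_cancel₀ h1
      linear_combination (p * p - q * q) * hz + hpq -
        D.σ (D.Zval z) * D.Zval z * q * q * h3)
    (by simp only [map_mul, map_inv₀, hpσ, hqσ, D.σ_γ, inv_neg]; ring)
  refine ⟨k, ?_, ⟨?_, ?_, ?_⟩, ?_⟩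
  · exact mem_cent_Y hx e1 (by rw [e2, mul_assoc]) (by rw [e3, mul_assoc]) e4
  · rw [e1, ← mul_sub_one]; exact D.pE_le (by omega) (D.pE_mul_left hzv.le hp1)
  · rw [e3]; exact D.pE_le (by omega) (D.pE_mul_left hzv.le hqγ)
  · rw [e4, ← mul_sub_one]; exact D.pE_le (by omega) (D.pE_mul_left hzv.le hp1)
  · rw [e2, ← mul_sub]; exact D.pE_le (by omega) (D.pE_mul_left hzv.le hqu)

variable (D d) in
/-- `ϖ⁻ᵈ ε⁻¹`. -/
def δY : F := (D.ϖ : F) ^ (-(d : ℤ)) * D.ε⁻¹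

theorem algebraMap_ϖ_pow_mem : algebraMap F E ((D.ϖ : F) ^ (-(d : ℤ))) ∈ D.pE (-(d : ℤ)) := by
  rw [map_zpow₀]; exact D.ϖ_zpow_mem_pE _

theorem algebraMap_δY_mem : algebraMap F E (D.δY d) ∈ D.pE (-(d : ℤ)) := by
  rw [δY, map_mul]
  refine D.pE_mul_right algebraMap_ϖ_pow_mem ?_
  rw [valuation_algebraMap_le_one_iff, map_inv₀, D.ε_unit, inv_one]

/-- The factor ε⁻¹ in `δY` comes from 1 / √ε = ε⁻¹ √ε in γ⁻¹. The other entries of Y_χ contribute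
nothing: the diagonal ones lie in 𝔭^(-r) and meet j - 1 in 𝔭^⌈d/2⌉, and the lower left one lies in
𝔭^(d-2r), all inside 𝔭 as d > 2r. -/
theorem ψ_trace_Y (hx : x + D.σ x ≠ 0) {r : ℕ} (hxr : x ∈ D.pE (-(r : ℤ))) (hd : 2 * r < d)
    {j : D.K} (hj : j ∈ D.J d) :
    D.ψ (Matrix.trace (D.Y hx d * (((j : D.K) : GL (Fin 2) E).1 - 1))) =
      D.ψ (algebraMap F E (D.δY d) * D.sqrtε * (j : GL (Fin 2) E) 1 0) := by
  obtain ⟨j1, j2, -, j4⟩ := hj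
  have h1 := D.γ_ne_zero hx d
  have e1 : (x + D.σ x) / 2 * (D.γ x d)⁻¹ = algebraMap F E (D.δY d) * D.sqrtε := by
    have h2 := D.two_ne_zero_E
    have h3 := D.sqrtε_ne_zero
    have h4 := D.algebraMap_ϖ_ne_zero
    rw [δY, γ, map_mul, map_zpow₀, map_inv₀, ← D.sqrtε_sq, _root_.zpow_neg, zpow_natCast]
    field_simp
  apply D.ψ_eq_of_sub_mem
  have e2 : Matrix.trace (D.Y hx d * (((j : D.K) : GL (Fin 2) E).1 - 1)) -
      algebraMap F E (D.δY d) * D.sqrtε * (j : GL (Fin 2) E) 1 0 =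
      (x - D.σ x) / 2 * (((j : GL (Fin 2) E) 0 0 - 1) + ((j : GL (Fin 2) E) 1 1 - 1)) +
      (x + D.σ x) / 2 * D.γ x d * (j : GL (Fin 2) E) 0 1 := by
    rw [← e1, Y_eq, trace_mul_sub_one]
    ring
  rw [e2]
  refine D.pE_add ?_ ?_
  · exact D.pE_le (by omega) (D.pE_mul (D.mem_pE_div_two (D.pE_sub hxr (D.pE_σ hxr)))
      (D.pE_add j1 j4))
  · exact D.pE_le (by omega) (D.pE_mul (D.pE_mul
      (D.mem_pE_div_two (D.pE_add hxr (D.pE_σ hxr))) (γ_mem_pE hxr)) j2)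

theorem exists_Y_admissible (hx : x + D.σ x ≠ 0) {r : ℕ} (hxr : x ∈ D.pE (-(r : ℤ)))
    (hd : 2 * r < d) {χ : D.T →* ℂˣ} (hχ : ∀ t ∈ D.Tfil (r + 1), χ t = 1)
    {θ : D.Z →* ℂˣ} (hθ : HasDepth D.Zfil θ 0) (hχθ : D.centralChar χ = θ) (hd0 : 0 < d) :
    ∃ h : D.Admissible d (D.Y hx d) (D.zeta χ hx d),
      ∀ (k : D.K) (hk : k ∈ D.cent (D.Y hx d) ⊔ D.J d) (hk' : k ∈ D.H d),
        h.char ⟨k, hk⟩ = D.charHom d hθ hd0 algebraMap_δY_mem ⟨k, hk'⟩ := by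
  subst hχθ
  exact exists_admissible hθ hd0 algebraMap_δY_mem (cent_Y_sup_J hx hxr hd)
    (cent_Y_isNear hx hxr hd hχ) fun j hj => ψ_trace_Y hx hxr hd hj

/-- Conjugation by `t(c)`, where `c` has norm `ε⁻¹`, takes one character of `Z 𝒰 𝒥_d` to the
other. -/
theorem exists_conj_charHom {θ : D.Z →* ℂˣ} (hθ : HasDepth D.Zfil θ 0) (hd : 0 < d) :
    ∃ g : D.K, (∀ k, k ∈ D.H d ↔ g⁻¹ * k * g ∈ D.H d) ∧
      ∀ k (h₂ : k ∈ D.H d) (h₁ : g⁻¹ * k * g ∈ D.H d),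
        D.charHom d hθ hd algebraMap_δY_mem ⟨k, h₂⟩ =
          D.charHom d hθ hd algebraMap_ϖ_pow_mem ⟨_, h₁⟩ := by
  obtain ⟨c, hc, hN⟩ := D.exists_norm_eq_inv_ε
  have hσ0 : D.σ (c : E) ≠ 0 := by rw [Ne, map_eq_zero]; exact c.ne_zero
  obtain ⟨g, e1, e2, e3, e4⟩ := D.exists_K (a := (c : E)) (b := 0) (c := 0) (e := (D.σ c)⁻¹) hc.le
    (by simp) (by simp) (by rw [map_inv₀, D.valuation_σ, hc, inv_one]) (by simp)
    (by simp [hσ0]) (by simp)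
  obtain ⟨i1, i2, i3, i4⟩ := D.K_inv g
  rw [e4, map_inv₀, D.σ_σ] at i1
  rw [e2, map_zero] at i2
  rw [e3, map_zero] at i3
  rw [e1] at i4
  -- Conjugation by t(c) fixes the diagonal entries and multiplies the lower left one by c σ(c) =
  -- ε⁻¹, which is the ratio of the two parameters.
  have hconj (k : D.K) : ((g⁻¹ * k * g : D.K) : GL (Fin 2) E) 0 0 = (k : GL (Fin 2) E) 0 0 ∧
      ((g⁻¹ * k * g : D.K) : GL (Fin 2) E) 1 0 =
        algebraMap F E D.ε⁻¹ * (k : GL (Fin 2) E) 1 0 ∧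
      ((g⁻¹ * k * g : D.K) : GL (Fin 2) E) 1 1 = (k : GL (Fin 2) E) 1 1 := by
    simp only [K_mul_apply, e1, e2, e3, e4, i1, i2, i3, i4, ← hN]
    refine ⟨?_, ?_, ?_⟩ <;> field_simp <;> ring
  have hε : valuation E (algebraMap F E D.ε⁻¹) = 1 := by
    rw [valuation_algebraMap_eq_one_iff, map_inv₀, D.ε_unit, inv_one]
  have hnear (k : D.K) (a : E) : D.IsNear d (g⁻¹ * k * g) a ↔ D.IsNear d k a := by
    obtain ⟨c1, c2, c3⟩ := hconj k
    rw [IsNear, IsNear, c1, c2, c3, D.mem_pE (x := _ * _), map_mul, hε, one_mul]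
    rfl
  refine ⟨g, fun k => exists_congr fun z => (hnear k _).symm, ?_⟩
  rintro k ⟨z, hz⟩ h₁
  refine (D.charFun_eq hθ hd algebraMap_δY_mem (k := ⟨k, z, hz⟩) hz).trans
    (Eq.trans ?_ (D.charFun_eq hθ hd algebraMap_ϖ_pow_mem (k := ⟨_, h₁⟩) ((hnear k _).2 hz)).symm)
  congr 2
  change _ = _ * ((g⁻¹ * k * g : D.K) : GL (Fin 2) E) 1 0
  rw [(hconj k).2.1, δY, map_mul]
  ring

theorem nonempty_equiv (hx : x + D.σ x ≠ 0) {r : ℕ} (hxr : x ∈ D.pE (-(r : ℤ)))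
    (hd : 2 * r < d) {χ : D.T →* ℂˣ} (hχ : ∀ t ∈ D.Tfil (r + 1), χ t = 1)
    {θ : D.Z →* ℂˣ} (hθ : HasDepth D.Zfil θ 0) (hχθ : D.centralChar χ = θ) :
    ∃ (h : D.Admissible d (D.Y hx d) (D.zeta χ hx d))
      (h₀ : D.Admissible d (D.nilp ((D.ϖ : F) ^ (-(d : ℤ)))) (D.nilpChar (D.ϖ_pow_ne_zero d) θ)),
      Nonempty ((Sd h).Equiv (Sd h₀)) := by
  have hd0 : 0 < d := by omega
  obtain ⟨h, hh⟩ := exists_Y_admissible hx hxr hd hχ hθ hχθ hd0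
  obtain ⟨h₀, hh₀⟩ := exists_nilp_admissible hθ hd0 (D.ϖ_pow_ne_zero d) algebraMap_ϖ_pow_mem
  obtain ⟨g, hg, hg'⟩ := exists_conj_charHom (d := d) hθ hd0
  have e := cent_Y_sup_J hx hxr hd
  have e₀ := cent_nilp_sup_J (D := D) (d := d) (D.ϖ_pow_ne_zero d)
  obtain ⟨φ⟩ : Nonempty ((Sd h₀).Equiv (Sd h)) := by
    refine nonempty_indRep_equiv _ _ g (fun k => by rw [e, e₀]; exact hg k) fun k h₂ h₁ => ?_
    rw [hh k h₂ (e ▸ h₂), hh₀ _ h₁ (e₀ ▸ h₁), hg']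
  exact ⟨h, h₀, ⟨φ.symm⟩⟩

end Torus

end UnramifiedData

/-- Over a finite ring, all additive characters are multiplicative shifts of a primitive one. -/
theorem AddChar.exists_mulShift_eq {R : Type*} [CommRing R] [Finite R] {ψ : AddChar R ℂ}
    (hψ : ψ.IsPrimitive) (φ : AddChar R ℂ) : ∃ a : R, ψ.mulShift a = φ := by
  have := Fintype.ofFinite R
  -- Primitivity makes a ↦ `ψ.mulShift a` injective, and R has as many additive characters as
  -- elements.
  exact (((Fintype.bijective_iff_injective_and_card _).2
    ⟨AddChar.to_mulShift_inj_of_isPrimitive hψ, AddChar.card_eq.symm⟩).2 φ)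

/-- Additive characters that are trivial on an ideal factor through the quotient. -/
theorem AddChar.exists_quotient {R : Type*} [CommRing R] (I : Ideal R) {M : Type*} [CommMonoid M]
    (f : AddChar R M) (hf : ∀ y ∈ I, f y = 1) :
    ∃ φ : AddChar (R ⧸ I) M, ∀ y, φ (Ideal.Quotient.mk I y) = f y := by
  have h : ∀ x y, Ideal.Quotient.mk I x = Ideal.Quotient.mk I y → f x = f y := by
    intro x y hxy
    rw [← sub_add_cancel x y, f.map_add_eq_mul, hf _ (Ideal.Quotient.eq.1 hxy), one_mul]
  have e : ∀ q : R ⧸ I, Ideal.Quotient.mk I q.out = q := Ideal.Quotient.mk_out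
  refine ⟨⟨fun q => f q.out, ?_, fun a b => ?_⟩, fun y => h _ _ (e _)⟩
  · rw [← f.map_zero_eq_one]
    exact h _ _ (by rw [e, map_zero])
  · rw [← f.map_add_eq_mul]
    exact h _ _ (by rw [e, map_add, e, e])

namespace UnramifiedData

variable {F E : Type*}
  [Field F] [ValuativeRel F] [TopologicalSpace F] [IsNonarchimedeanLocalField F]
  [Field E] [ValuativeRel E] [TopologicalSpace E] [IsNonarchimedeanLocalField E]
  [Algebra F E] [ValuativeExtension F E]

/-! ### Self-duality of 𝒪_E / 𝔭_E^N through ψ -/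

section Duality

variable (D : UnramifiedData F E)

theorem mem_maximalIdeal_pow_iff (N : ℕ) (y : 𝒪[E]) : y ∈ 𝓂[E] ^ N ↔ (y : E) ∈ D.pE N := by
  let π : 𝒪[E] := ⟨algebraMap F E D.ϖ, D.valuation_algebraMap_ϖ_lt_one.le⟩
  have hdvd (M : ℕ) (y : 𝒪[E]) : π ^ M ∣ y ↔ (y : E) ∈ D.pE M := by
    constructor
    · rintro ⟨c, rfl⟩
      have h := D.ϖ_zpow_mem_pE M
      rw [zpow_natCast] at h
      exact D.pE_mul_right h c.2
    · intro h
      refine ⟨⟨(y : E) / algebraMap F E D.ϖ ^ (M : ℤ), D.mem_pE_zero.1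
        (D.pE_div_ϖ_zpow (by simpa using h))⟩, Subtype.ext ?_⟩
      change (y : E) = algebraMap F E D.ϖ ^ M * (_ / _)
      rw [zpow_natCast, mul_div_cancel₀ _ (pow_ne_zero _ D.algebraMap_ϖ_ne_zero)]
  have h1 : 𝓂[E] = Ideal.span {π} := by
    ext y
    rw [mem_maximalIdeal_iff_valuation_lt_one, Ideal.mem_span_singleton, ← D.mem_pE_one_iff]
    simpa using (hdvd 1 y).symm
  rw [h1, Ideal.span_singleton_pow, Ideal.mem_span_singleton, hdvd]

/-- Every character of `𝒪_E` that is trivial on `𝔭_E ^ N` is `y ↦ ψ (ϖ ^ (1 - N) X y)` for some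
`X ∈ 𝒪_E`. -/
theorem exists_eq_ψ (N : ℕ) (f : AddChar 𝒪[E] ℂ) (hf : ∀ y : 𝒪[E], (y : E) ∈ D.pE N → f y = 1) :
    ∃ X : 𝒪[E], ∀ y : 𝒪[E], f y = D.ψ (algebraMap F E D.ϖ ^ (1 - (N : ℤ)) * (X * y)) := by
  set c := algebraMap F E D.ϖ ^ (1 - (N : ℤ)) with hc
  have hc0 : c ≠ 0 := zpow_ne_zero _ D.algebraMap_ϖ_ne_zero
  let g : AddChar 𝒪[E] ℂ := ⟨fun y => D.ψ (c * y), by simp [D.ψ_zero], fun a b => by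
    rw [Subring.coe_add, mul_add, D.ψ_add]⟩
  have hfin : Finite (𝒪[E] ⧸ 𝓂[E] ^ N) := by
    have : Finite (𝒪[E] ⧸ 𝓂[E]) := inferInstanceAs (Finite 𝓀[E])
    exact Ideal.finite_quotient_pow (IsNoetherian.noetherian _) N
  obtain ⟨φ, hφ⟩ := AddChar.exists_quotient (𝓂[E] ^ N) f
    fun y hy => hf y ((D.mem_maximalIdeal_pow_iff N y).1 hy)
  obtain ⟨ρ, hρ⟩ := AddChar.exists_quotient (𝓂[E] ^ N) g fun y hy =>
    D.ψ_eq_one (D.pE_le (by omega) (D.pE_mul (D.ϖ_zpow_mem_pE _)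
      ((D.mem_maximalIdeal_pow_iff N y).1 hy)))
  -- If a ∉ 𝔭^N, then |c a| ≥ 1, so a point y ∈ 𝒪_E with ψ(y) ≠ 1 can be written as c a (y / (c a))
  -- with an integral second factor.
  have hprim : ρ.IsPrimitive := by
    intro a ha h
    obtain ⟨a, rfl⟩ := Ideal.Quotient.mk_surjective a
    rw [Ne, Ideal.Quotient.eq_zero_iff_mem, D.mem_maximalIdeal_pow_iff] at ha
    obtain ⟨y, hy, hψ⟩ := D.exists_ψ_ne_one
    have ha0 : (a : E) ≠ 0 := fun h => ha (h ▸ D.zero_mem_pE)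
    have hca : valuation E (y / (c * a)) ≤ 1 := by
      have h1 : valuation E (algebraMap F E D.ϖ) ^ ((N : ℤ) - 1) ≤ valuation E (a : E) := by
        rw [← not_lt, ← D.mem_pE_succ_iff, sub_add_cancel]
        exact ha
      have h2 : 1 ≤ valuation E (c * a) := by
        rw [map_mul, hc, map_zpow₀, ← neg_sub, _root_.zpow_neg,
          ← div_eq_inv_mul, one_le_div₀ (zpow_pos D.valuation_algebraMap_ϖ_pos _)]
        exact h1
      rw [map_div₀]
      exact div_le_one_of_le₀ (hy.trans h2) zero_le
    have h3 := DFunLike.congr_fun h (Ideal.Quotient.mk _ ⟨_, hca⟩)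
    rw [AddChar.mulShift_apply, ← map_mul, hρ] at h3
    apply hψ
    rw [← AddChar.one_apply (Ideal.Quotient.mk (𝓂[E] ^ N) ⟨_, hca⟩), ← h3]
    change _ = D.ψ (c * (a * (y / (c * a))))
    congr 1
    field_simp
  obtain ⟨X, hX⟩ := AddChar.exists_mulShift_eq hprim φ
  obtain ⟨X, rfl⟩ := Ideal.Quotient.mk_surjective X
  refine ⟨X, fun y => ?_⟩
  rw [← hφ, ← hX, AddChar.mulShift_apply, ← map_mul, hρ]
  rfl

end Duality

/-! ### Existence of Γ -/

section Realization

variable {D : UnramifiedData F E} {r : ℕ} {χ : D.T →* ℂˣ}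

theorem apply_t_eq_of_sub_mem (hχ : ∀ t ∈ D.Tfil (r + 1), χ t = 1) {a b : Eˣ}
    (hb : valuation E (b : E) = 1) (h : (a : E) - b ∈ D.pE (r + 1)) : χ (D.t a) = χ (D.t b) := by
  rw [← mul_inv_eq_one, ← map_inv, ← map_inv, ← map_mul, ← map_mul]
  refine hχ _ (t_mem_Tfil (by omega) ?_)
  have e : ((a * b⁻¹ : Eˣ) : E) - 1 = ((a : E) - b) * (b : E)⁻¹ := by
    rw [Units.val_mul, Units.val_inv_eq_inv_val]
    field_simp
  rw [e]
  push_cast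
  exact D.pE_mul_right h (by rw [map_inv₀, hb, inv_one])

/-- By σ-invariance of ψ the second diagonal entry contributes ψ(-x (a⁻¹ - 1)), and a⁻¹ - 1 ≡ -(a -
1) up to (a - 1)². That error dies because 2 (⌊r/2⌋ + 1) ≥ r + 1. Thus χ has to be matched with a ↦
ψ(2x (a - 1)). -/
theorem ψ_trace_Γ {x : E} (hx : x ∈ D.pE (-(r : ℤ))) {a : Eˣ}
    (ha : (a : E) - 1 ∈ D.pE (r / 2 + 1 : ℕ)) :
    D.ψ (Matrix.trace (D.Γ x * (((D.t a : D.T) : GL (Fin 2) E).1 - 1))) =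
      D.ψ (2 * x * (a - 1)) := by
  have hav := D.valuation_eq_one_of_sub_one_mem (by omega) ha
  rw [show ((D.t a : D.T) : GL (Fin 2) E) = D.tor a from rfl, tor_val, Γ, trace_mul_sub_one]
  have e1 : x * ((!![(a : E), 0; 0, (D.σ a)⁻¹] : Matrix (Fin 2) (Fin 2) E) 0 0 - 1) +
      0 * (!![(a : E), 0; 0, (D.σ a)⁻¹] : Matrix (Fin 2) (Fin 2) E) 1 0 +
      (0 * (!![(a : E), 0; 0, (D.σ a)⁻¹] : Matrix (Fin 2) (Fin 2) E) 0 1 +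
      -D.σ x * ((!![(a : E), 0; 0, (D.σ a)⁻¹] : Matrix (Fin 2) (Fin 2) E) 1 1 - 1)) =
      x * (a - 1) + D.σ (-(x * ((a : E)⁻¹ - 1))) := by
    simp
  rw [e1, ψ_add, ψ_σ, ← ψ_add]
  apply D.ψ_eq_of_sub_mem
  have e2 : x * ((a : E) - 1) + -(x * ((a : E)⁻¹ - 1)) - 2 * x * (a - 1) =
      -(x * ((a - 1) * (a - 1)) * (a : E)⁻¹) := by
    field_simp
    ring
  rw [e2]
  refine D.pE_neg (D.pE_mul_right ?_ (by rw [map_inv₀, hav, inv_one]))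
  exact D.pE_le (by omega) (D.pE_mul hx (D.pE_mul ha ha))

/-- The map y ↦ χ(t(1 + ϖ^n y)) is additive on 𝒪_E, since the cross term lies in 𝔭^(2n) ⊂ 𝔭^(r+1),
and is trivial on 𝔭^N for N = r + 1 - n. Duality writes it as y ↦ ψ(ϖ^(1-N) X y), and x is read off
from ϖ^(1-N) = ϖ^(-r) ϖ^n. -/
theorem exists_realizes (hr : 0 < r) (hχ : ∀ t ∈ D.Tfil (r + 1), χ t = 1) :
    ∃ x : E, D.Realizes χ r x := by
  obtain ⟨n, hn⟩ : ∃ n, n = r / 2 + 1 := ⟨_, rfl⟩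
  obtain ⟨N, hN⟩ : ∃ N, N + n = r + 1 := ⟨r + 1 - n, by omega⟩
  set π := algebraMap F E D.ϖ with hπ
  have hπ0 : π ≠ 0 := D.algebraMap_ϖ_ne_zero
  have hmem {m : ℤ} {y : E} (hy : y ∈ D.pE m) : π ^ n * y ∈ D.pE (n + m) := by
    have h := D.ϖ_zpow_mem_pE n
    rw [zpow_natCast] at h
    exact D.pE_mul h hy
  have hmem' (y : 𝒪[E]) : 1 + π ^ n * (y : E) - 1 ∈ D.pE n := by
    rw [add_sub_cancel_left]
    simpa using hmem (D.mem_pE_zero.2 y.2)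
  have hv (y : 𝒪[E]) : valuation E (1 + π ^ n * (y : E)) = 1 :=
    D.valuation_eq_one_of_sub_one_mem (by omega) (hmem' y)
  have h0 (y : 𝒪[E]) : 1 + π ^ n * (y : E) ≠ 0 := by
    intro h
    have := hv y
    rw [h, map_zero] at this
    exact zero_ne_one this
  let U (y : 𝒪[E]) : Eˣ := Units.mk0 _ (h0 y)
  have hU0 : U 0 = 1 := Units.ext (by simp [U])
  have hUadd (y y' : 𝒪[E]) : χ (D.t (U y)) * χ (D.t (U y')) = χ (D.t (U (y + y'))) := by
    rw [← map_mul, ← map_mul]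
    refine apply_t_eq_of_sub_mem hχ (hv _) ?_
    have e : ((U y * U y' : Eˣ) : E) - U (y + y') = π ^ n * y * (π ^ n * y') := by
      simp only [U, Units.val_mul, Units.val_mk0, Subring.coe_add]
      ring
    rw [e]
    have h1 := D.pE_mul (hmem (D.mem_pE_zero.2 y.2)) (hmem (D.mem_pE_zero.2 y'.2))
    exact D.pE_le (by omega) h1
  let f : AddChar 𝒪[E] ℂ := ⟨fun y => (χ (D.t (U y)) : ℂ), by simp [hU0], fun y y' => by
    rw [← hUadd, Units.val_mul]⟩
  obtain ⟨X, hX⟩ := D.exists_eq_ψ N f (fun y hy => by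
    have h1 : χ (D.t (U y)) = 1 := by
      refine hχ _ (t_mem_Tfil (by omega) ?_)
      have e : ((U y : Eˣ) : E) - 1 = π ^ n * y := by simp [U]
      rw [e]
      exact D.pE_le (by omega) (hmem hy)
    change (χ (D.t (U y)) : ℂ) = 1
    rw [h1, Units.val_one])
  -- The division by 2 cancels the factor 2 in `ψ_trace_Γ`.
  have hxm : π ^ (-(r : ℤ)) * X / 2 ∈ D.pE (-(r : ℤ)) :=
    D.mem_pE_div_two (D.pE_mul_right (D.ϖ_zpow_mem_pE _) X.2)
  refine ⟨_, hxm, ?_⟩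
  rintro _ ⟨a, ⟨-, ha⟩, rfl⟩
  change (a : E) - 1 ∈ D.pE (r / 2 + 1 : ℕ) at ha
  rw [ψ_trace_Γ hxm ha]
  let y : 𝒪[E] := ⟨((a : E) - 1) / π ^ (n : ℤ), D.mem_pE_zero.1 (D.pE_div_ϖ_zpow (by
    rw [add_zero, hn]; exact ha))⟩
  have hy : U y = a := by
    apply Units.ext
    simp only [U, y, Units.val_mk0, zpow_natCast]
    field_simp
    ring
  have h1 : (χ (D.t a) : ℂ) = f y := by
    change _ = (χ (D.t (U y)) : ℂ)
    rw [hy]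
  rw [h1, hX]
  congr 1
  have h2 := D.two_ne_zero_E
  have e : (1 - (N : ℤ)) = -(r : ℤ) + n := by omega
  rw [e, zpow_add₀ hπ0]
  simp only [y]
  field_simp

end Realization

end UnramifiedData

end

theorem theorem7p1 {F E : Type*}
    [Field F] [ValuativeRel F] [TopologicalSpace F] [IsNonarchimedeanLocalField F]
    [Field E] [ValuativeRel E] [TopologicalSpace E] [IsNonarchimedeanLocalField E]
    [Algebra F E] [ValuativeExtension F E]
    (D : UnramifiedData F E)
    (r : ℕ) (hr : 0 < r) (χ : D.T →* ℂˣ) (hχ : D.HasMinimalDepth χ r)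
    (hθ : HasDepth D.Zfil (D.centralChar χ) 0) :
    (∃ x : E, D.Realizes χ r x) ∧
    (∀ (x : E) (hx : D.Realizes χ r x) (d : ℕ), 2 * r < d →
      ∃ (h : D.Admissible d (D.Y (hx.ne_zero hr hχ) d) (D.zeta χ (hx.ne_zero hr hχ) d))
        (h₀ : D.Admissible d (D.nilp ((D.ϖ : F) ^ (-(d : ℤ))))
          (D.nilpChar (D.ϖ_pow_ne_zero d) (D.centralChar χ))),
        Nonempty ((UnramifiedData.Sd h).Equiv (UnramifiedData.Sd h₀))) ∧
    (∀ (x : E) (hx : D.Realizes χ r x) (r' : ℕ) (hr' : 0 < r') (χ' : D.T →* ℂˣ)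
      (hχ' : D.HasMinimalDepth χ' r') (x' : E) (hx' : D.Realizes χ' r' x') (d : ℕ),
      D.centralChar χ' = D.centralChar χ → 2 * r < d → 2 * r' < d →
      ∃ (h : D.Admissible d (D.Y (hx.ne_zero hr hχ) d) (D.zeta χ (hx.ne_zero hr hχ) d))
        (h' : D.Admissible d (D.Y (hx'.ne_zero hr' hχ') d) (D.zeta χ' (hx'.ne_zero hr' hχ') d)),
        Nonempty ((UnramifiedData.Sd h).Equiv (UnramifiedData.Sd h'))) := by
  refine ⟨UnramifiedData.exists_realizes hr hχ.1.2, fun x hx d hd =>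
    UnramifiedData.nonempty_equiv _ hx.1 hd hχ.1.2 hθ rfl, ?_⟩
  intro x hx r' hr' χ' hχ' x' hx' d hc hd hd'
  obtain ⟨h, h₀, ⟨φ⟩⟩ := UnramifiedData.nonempty_equiv (hx.ne_zero hr hχ) hx.1 hd hχ.1.2 hθ rfl
  -- The equality of central characters lets χ' inherit depth zero and be compared with the same
  -- nilpotent representation.
  obtain ⟨h', h₀', ⟨φ'⟩⟩ :=
    UnramifiedData.nonempty_equiv (hx'.ne_zero hr' hχ') hx'.1 hd' hχ'.1.2 hθ hc
  exact ⟨h, h', ⟨φ.trans φ'.symm⟩⟩
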